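/- **Setup.** Let $n$ be even and $q\ge 2$, and consider $n$ qudits of local dimension $q$, numbered $0,\dots,n-1$ and arranged on a ring, starting in the state $|0\rangle^{\otimes n}$. The one-dimensional brickwork architecture of depth $d\ge 1$ with periodic boundary has, at each odd timestep $t\in\{1,\dots,d\}$, an entangling gate on each pair of sites $(2j,2j+1)$ and, at each even timestep, an entangling gate on each pair $(2j,2j-1 \bmod n)$, for $0\le j<n/2$. The entangling gates $V$ are independent random unitaries, each drawn from a probability measure on $\mathrm U(q^2)$ that is a unitary 2-design. Each entangling gate may be immediately preceded and immediately succeeded by any finite number of parameterized gates acting on one or both of its two sites; a parameterized gate has the form $W_l e^{-iA\theta}W_r$ with $W_l,W_r$ fixed unitaries, $A$ Hermitian, and $\theta\mapsto e^{-iA\theta}$ periodic with period $2\pi$; it has its own parameter $\theta\in[0,2\pi]$. Let $U(\boldsymbol\theta)$ be the resulting circuit. Let $M_0=I,M_1,\dots,M_{q^2-1}$ be $q\times q$ matrices with $\operatorname{tr}(M_i^\dagger M_j)=q\,\delta_{ij}$, and for $\mathbf x\in\{0,\dots,q^2-1\}^n$ put $M_{\mathbf x}=\bigotimes_i M_{\mathbf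 x_i}$ and $$g_{\mathbf x}=\mathbb E_V\,\mathbb E_{\boldsymbol\theta}\,\bigl|\langle 0^n|U(\boldsymbol\theta)^\dagger M_{\mathbf x}U(\boldsymbol\theta)|0^n\rangle\bigr|^2,$$ where $\boldsymbol\theta$ is uniform on the product of the intervals $[0,2\pi]$. Call $M_{\mathbf x}$ spatially $k$-local if all sites $i$ with $\mathbf x_i\neq 0$ lie within $k$ adjacent sites of the ring. **Claim.** There is an absolute constant $C>0$ such that for all such $q,n,d$, all such circuits, 2-designs and matrices $M_i$, all $k\ge 0$, and all $\mathbf x$ for which $M_{\mathbf x}$ is spatially $k$-local, $$g_{\mathbf x}\;\ge\;\max\bigl\{q^{-C(d+k)},\,(q+1)^{-n}\bigr\},$$ and, more specifically, $$g_{\mathbf x}\;\ge\;\max\bigl\{(q+1)^{-k}(q^2+1)^{-(d+1)},\,(q+1)^{-n}\bigr\}.$$ -/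

import Mathlib

namespace VariationalCircuit

noncomputable section

/-! ### Unitary groups, Haar measure and 2-designs -/

section Unitary

variable (ι : Type*) [Fintype ι] [DecidableEq ι]

/-- The unitary group carries its Borel sigma-algebra. -/
instance instMeasurableSpaceUnitaryGroup : MeasurableSpace (Matrix.unitaryGroup ι ℂ) :=
  borel _

instance instBorelSpaceUnitaryGroup : BorelSpace (Matrix.unitaryGroup ι ℂ) := ⟨rfl⟩

/-- The unitary group is compact. -/
instance instCompactSpaceUnitaryGroup : CompactSpace (Matrix.unitaryGroup ι ℂ) := by
  have hK : IsCompact (Set.univ.pi fun _ : ι => Set.univ.pi fun _ : ι =>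
      Metric.closedBall (0 : ℂ) 1) :=
    isCompact_univ_pi fun _ => isCompact_univ_pi fun _ => isCompact_closedBall _ _
  have hclosed : IsClosed ((Matrix.unitaryGroup ι ℂ : Set (Matrix ι ι ℂ))) := by
    have h : (Matrix.unitaryGroup ι ℂ : Set (Matrix ι ι ℂ)) =
        {A | A * star A = 1} := by
      ext A
      exact Matrix.mem_unitaryGroup_iff
    rw [h]
    exact isClosed_eq (by fun_prop) continuous_const
  have hsub : (Matrix.unitaryGroup ι ℂ : Set (Matrix ι ι ℂ)) ⊆
      (Set.univ.pi fun _ : ι => Set.univ.pi fun _ : ι => Metric.closedBall (0 : ℂ) 1) := by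
    intro A hA i _ j _
    simpa using entry_norm_bound_of_unitary hA i j
  exact isCompact_iff_compactSpace.mp (hK.of_isClosed_subset hclosed hsub)

/-- The Haar probability measure on the unitary group. -/
def haarUnitary : MeasureTheory.Measure (Matrix.unitaryGroup ι ℂ) :=
  MeasureTheory.Measure.haarMeasure ⊤

variable {ι}

/-- A probability measure on the unitary group is a *2-design* if its second moments, i.e. the
entries of `E[U ⊗ U ⊗ conj U ⊗ conj U]`, agree with those of the Haar measure. -/
structure IsTwoDesign (μ : MeasureTheory.Measure (Matrix.unitaryGroup ι ℂ)) : Prop where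
  isProbabilityMeasure : MeasureTheory.IsProbabilityMeasure μ
  moments : ∀ a a' b b' c c' e e' : ι,
    ∫ U : Matrix.unitaryGroup ι ℂ,
        (U : Matrix ι ι ℂ) a a' * (U : Matrix ι ι ℂ) b b' *
          star ((U : Matrix ι ι ℂ) c c') * star ((U : Matrix ι ι ℂ) e e') ∂μ =
      ∫ U : Matrix.unitaryGroup ι ℂ,
        (U : Matrix ι ι ℂ) a a' * (U : Matrix ι ι ℂ) b b' *
          star ((U : Matrix ι ι ℂ) c c') * star ((U : Matrix ι ι ℂ) e e') ∂(haarUnitary ι)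

end Unitary

/-! ### States and operators on `n` qudits of dimension `q` -/

/-- Operators on two qudits. -/
abbrev PairOp (q : ℕ) := Matrix (Fin q × Fin q) (Fin q × Fin q) ℂ

/-- Operators on `n` qudits, written in the computational basis. -/
abbrev Op (q n : ℕ) := Matrix (Fin n → Fin q) (Fin n → Fin q) ℂ

/-- The starting state, `n` copies of `|0⟩`. -/
def zeroKet (q n : ℕ) [NeZero q] : (Fin n → Fin q) → ℂ := Pi.single (fun _ => 0) 1

/-- The two-qudit operator `G` acting on the (ordered) pair of sites `i`, `j` and as the identity
on all other sites. -/
def onPair {q n : ℕ} (i j : Fin n) (G : PairOp q) : Op q n :=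
  Matrix.of fun s t =>
    if ∀ l, l ≠ i → l ≠ j → s l = t l then G (s i, s j) (t i, t j) else 0

/-- A family `M 0, …, M (q ^ 2 - 1)` of `q × q` matrices, orthogonal for the Hilbert–Schmidt inner
product, with `M 0` the identity and `tr ((M a)ᴴ * M b) = q δ_{a,b}`. -/
structure IsOperatorBasis {q : ℕ} [NeZero q]
    (M : Fin (q ^ 2) → Matrix (Fin q) (Fin q) ℂ) : Prop where
  zero_eq_one : M 0 = 1
  trace_eq : ∀ a b, ((M a).conjTranspose * M b).trace = if a = b then (q : ℂ) else 0

/-- `M_x`, the tensor product of the `M (x i)` over the sites `i`. -/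
def tensorOp {q n : ℕ} (M : Fin (q ^ 2) → Matrix (Fin q) (Fin q) ℂ)
    (x : Fin n → Fin (q ^ 2)) : Op q n :=
  Matrix.of fun s t => ∏ i, M (x i) (s i) (t i)

/-- `M_x` is spatially `k`-local on the ring of `n` sites: the support of `x` lies within `k`
adjacent sites `a, a + 1, …, a + k - 1` (modulo `n`). -/
def IsSpatiallyLocal {q n : ℕ} [NeZero q] (k : ℕ) (x : Fin n → Fin (q ^ 2)) : Prop :=
  ∃ a : ℕ, ∀ i : Fin n, x i ≠ 0 → ∃ r < k, (i : ℕ) = (a + r) % n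

/-! ### Parameterized gates -/

/-- A parameterized gate `W_l exp(-iAθ) W_r` on (one or both sites of) a pair of qudits, with `A`
Hermitian and `exp(-iAθ)` periodic in `θ` with period `2π`. Gates on one of the two sites are
those for which `A`, `W_l`, `W_r` act trivially on the other one. -/
structure ParamGate (q : ℕ) where
  A : PairOp q
  isHermitian : A.IsHermitian
  periodic : Function.Periodic
    (fun θ : ℝ => NormedSpace.exp (-(Complex.I * (θ : ℂ)) • A)) (2 * Real.pi)
  Wl : Matrix.unitaryGroup (Fin q × Fin q) ℂ
  Wr : Matrix.unitaryGroup (Fin q × Fin q) ℂ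

/-- The unitary implemented by a parameterized gate at parameter value `θ`. -/
def ParamGate.eval {q : ℕ} (P : ParamGate q) (θ : ℝ) : PairOp q :=
  (P.Wl : PairOp q) * NormedSpace.exp (-(Complex.I * (θ : ℂ)) • P.A) * (P.Wr : PairOp q)

/-! ### The 1D brickwork architecture with periodic boundary -/

/-- The entangling gates: the gate `(t, j)` is the `j`-th gate of timestep `t + 1`. -/
abbrev GateIdx (n d : ℕ) := Fin d × Fin (n / 2)

/-- The first site `2j` of the `j`-th gate of a layer. -/
def fstSite {n : ℕ} (j : Fin (n / 2)) : Fin n := ⟨2 * j, by omega⟩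

/-- The second site of the `j`-th gate of timestep `τ` (timesteps are numbered from `1`): it is
`2j + 1` if `τ` is odd and `2j - 1` modulo `n` if `τ` is even. -/
def sndSite {n : ℕ} (τ : ℕ) (j : Fin (n / 2)) : Fin n :=
  if Odd τ then ⟨2 * j + 1, by omega⟩
  else ⟨(2 * j + n - 1) % n, Nat.mod_lt _ (by have := j.isLt; omega)⟩

/-- The parameterized gates of an ansatz with brickwork entangling gates of depth `d` on `n` qudits:
each entangling gate is immediately preceded and succeeded by an arbitrary finite number of
parameterized gates acting on its sites. In `pre g` and `post g`, index `0` is applied first. -/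
structure BrickworkAnsatz (q n d : ℕ) where
  numPre : GateIdx n d → ℕ
  numPost : GateIdx n d → ℕ
  pre : ∀ g, Fin (numPre g) → ParamGate q
  post : ∀ g, Fin (numPost g) → ParamGate q

namespace BrickworkAnsatz

variable {q n d : ℕ}

/-- The parameters of the ansatz, one for each parameterized gate. -/
abbrev ParamIdx (𝒜 : BrickworkAnsatz q n d) :=
  (Σ g, Fin (𝒜.numPre g)) ⊕ (Σ g, Fin (𝒜.numPost g))

/-- The `j`-th entangling gate of a layer together with its surrounding parameterized gates, as an
operator on its two sites. Operators applied later stand further to the left. -/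
def block (𝒜 : BrickworkAnsatz q n d)
    (V : GateIdx n d → Matrix.unitaryGroup (Fin q × Fin q) ℂ) (θ : 𝒜.ParamIdx → ℝ)
    (g : GateIdx n d) : PairOp q :=
  (List.ofFn fun l => (𝒜.post g l).eval (θ (Sum.inr ⟨g, l⟩))).reverse.prod *
    (V g : PairOp q) *
    (List.ofFn fun l => (𝒜.pre g l).eval (θ (Sum.inl ⟨g, l⟩))).reverse.prod

/-- The layer of timestep `t + 1`. (Its blocks act on disjoint pairs of sites.) -/
def layer (𝒜 : BrickworkAnsatz q n d)
    (V : GateIdx n d → Matrix.unitaryGroup (Fin q × Fin q) ℂ) (θ : 𝒜.ParamIdx → ℝ)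
    (t : Fin d) : Op q n :=
  (List.ofFn fun j : Fin (n / 2) =>
    onPair (fstSite j) (sndSite (t + 1) j) (𝒜.block V θ (t, j))).prod

/-- The whole circuit `U(θ)`, for the realization `V` of the entangling gates. -/
def circuit (𝒜 : BrickworkAnsatz q n d)
    (V : GateIdx n d → Matrix.unitaryGroup (Fin q × Fin q) ℂ) (θ : 𝒜.ParamIdx → ℝ) : Op q n :=
  (List.ofFn fun t : Fin d => 𝒜.layer V θ t).reverse.prod

/-- The expectation value `⟨0^n| U(θ)† O U(θ) |0^n⟩`. -/
def expval [NeZero q] (𝒜 : BrickworkAnsatz q n d)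
    (V : GateIdx n d → Matrix.unitaryGroup (Fin q × Fin q) ℂ) (θ : 𝒜.ParamIdx → ℝ)
    (O : Op q n) : ℂ :=
  star (zeroKet q n) ⬝ᵥ
    (((𝒜.circuit V θ).conjTranspose * O * 𝒜.circuit V θ).mulVec (zeroKet q n))

/-- `g_x = E_V E_θ |⟨0^n| U(θ)† M_x U(θ) |0^n⟩|²`, where the entangling gates `V g` are independent
with laws `μ g` and the parameters are independent and uniform on `[0, 2π]`. -/
def gVal [NeZero q] (𝒜 : BrickworkAnsatz q n d)
    (μ : GateIdx n d → MeasureTheory.Measure (Matrix.unitaryGroup (Fin q × Fin q) ℂ))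
    (M : Fin (q ^ 2) → Matrix (Fin q) (Fin q) ℂ) (x : Fin n → Fin (q ^ 2)) : ℝ :=
  ∫ V, (∫ θ : 𝒜.ParamIdx → ℝ, ‖𝒜.expval V θ (tensorOp M x)‖ ^ 2
      ∂(MeasureTheory.Measure.pi fun _ =>
        ProbabilityTheory.cond MeasureTheory.volume (Set.Icc (0 : ℝ) (2 * Real.pi))))
    ∂(MeasureTheory.Measure.pi μ)

end BrickworkAnsatz

end

end VariationalCircuit

/-!
A sesquilinear form that is invariant under conjugation by all unitaries is a combination of
`⟨tr A, tr B⟩` and the Hilbert–Schmidt inner product. Averaging over a 2-design produces such a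
form, so a random two-site gate replaces a nontrivial pair of labels of `M_x` by a uniformly random
nontrivial pair, and fixes the trivial pair. Peeling off the gates in the Heisenberg picture, the
second moment of `⟨M_x⟩` thus becomes the expectation of a Markov chain on the labels `x`.

In each layer, the gate at one end of an arc carrying the support of `x` makes the end site trivial
with probability at least `(q² - 1) / (q⁴ - 1) = 1 / (q² + 1)`, and then the arc moves on by one
site and is again a union of pairs of the preceding layer. Once only the first timestep is left,
each of its gates touched by the support contributes a factor `1 / (q² + 1)`, because
`∑ₐ |⟨0|M_a|0⟩|² = q`. There are at most `n / 2` such gates, whence the bound `(q + 1)^{-n}`, and at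
most half the length of the arc, whence the bound for spatially local operators.
-/

namespace VariationalCircuit

noncomputable section

open MeasureTheory Matrix Kronecker

section Heisenberg

variable {ι : Type*} [Fintype ι] [DecidableEq ι]

/-- The observable `A` in the Heisenberg picture, after evolution of the states by `U`. -/
def heisenberg (U : Matrix ι ι ℂ) : Matrix ι ι ℂ →ₗ[ℂ] Matrix ι ι ℂ :=
  LinearMap.mulRight ℂ U ∘ₗ LinearMap.mulLeft ℂ Uᴴ

theorem heisenberg_apply (U A : Matrix ι ι ℂ) : heisenberg U A = Uᴴ * A * U := rfl

theorem heisenberg_mul (U V A : Matrix ι ι ℂ) :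
    heisenberg (U * V) A = heisenberg V (heisenberg U A) := by
  simp only [heisenberg_apply, conjTranspose_mul, Matrix.mul_assoc]

theorem conjTranspose_heisenberg (U A : Matrix ι ι ℂ) :
    (heisenberg U A)ᴴ = heisenberg U Aᴴ := by
  simp only [heisenberg_apply, conjTranspose_mul, conjTranspose_conjTranspose, Matrix.mul_assoc]

theorem heisenberg_one (U : unitaryGroup ι ℂ) : heisenberg (U : Matrix ι ι ℂ) 1 = 1 := by
  rw [heisenberg_apply, Matrix.mul_one]
  exact mem_unitaryGroup_iff'.mp U.2

theorem heisenberg_mul_heisenberg (U : unitaryGroup ι ℂ) (A B : Matrix ι ι ℂ) :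
    heisenberg (U : Matrix ι ι ℂ) A * heisenberg (U : Matrix ι ι ℂ) B =
      heisenberg (U : Matrix ι ι ℂ) (A * B) := by
  have hU : (U : Matrix ι ι ℂ) * (U : Matrix ι ι ℂ)ᴴ = 1 := mem_unitaryGroup_iff.mp U.2
  simp only [heisenberg_apply]
  calc _ = (U : Matrix ι ι ℂ)ᴴ * A * ((U : Matrix ι ι ℂ) * (U : Matrix ι ι ℂ)ᴴ) * B * U := by
        simp only [Matrix.mul_assoc]
    _ = _ := by rw [hU, Matrix.mul_one, Matrix.mul_assoc _ A]

theorem trace_heisenberg (U : unitaryGroup ι ℂ) (A : Matrix ι ι ℂ) :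
    (heisenberg (U : Matrix ι ι ℂ) A).trace = A.trace := by
  have hU : (U : Matrix ι ι ℂ) * (U : Matrix ι ι ℂ)ᴴ = 1 := mem_unitaryGroup_iff.mp U.2
  rw [heisenberg_apply, trace_mul_comm, ← Matrix.mul_assoc, hU, Matrix.one_mul]

theorem continuous_heisenberg (A : Matrix ι ι ℂ) :
    Continuous fun U : Matrix ι ι ℂ => heisenberg U A := by
  simp only [heisenberg_apply]
  fun_prop

theorem heisenberg_single (U : Matrix ι ι ℂ) (i j : ι) :
    heisenberg U (single i j 1) = of fun a b => star (U i a) * U j b := by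
  ext a b
  simp [heisenberg_apply, mul_apply, single_apply, ite_and]

end Heisenberg

section InvariantForms

variable {ι : Type*} [Fintype ι] [DecidableEq ι]

theorem matrix_eq_sum_smul_single (A : Matrix ι ι ℂ) :
    A = ∑ i, ∑ j, A i j • single i j (1 : ℂ) := by
  conv_lhs => rw [matrix_eq_sum_single A]
  simp only [smul_single, smul_eq_mul, mul_one]

theorem sesqForm_apply_eq_sum (Q : Matrix ι ι ℂ →ₗ⋆[ℂ] Matrix ι ι ℂ →ₗ[ℂ] ℂ)
    (A B : Matrix ι ι ℂ) :
    Q A B = ∑ i, ∑ j, star (A i j) * ∑ k, ∑ l, B k l * Q (single i j 1) (single k l 1) := by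
  calc Q A B = ∑ i, ∑ j, star (A i j) * Q (single i j 1) B := by
        conv_lhs => rw [matrix_eq_sum_smul_single A]
        simp only [map_sum, LinearMap.sum_apply, map_smulₛₗ, LinearMap.smul_apply, smul_eq_mul,
          starRingEnd_apply]
    _ = _ := by
        conv_lhs => rw [matrix_eq_sum_smul_single B]
        simp only [map_sum, map_smul, smul_eq_mul]

/-- The diagonal unitary with entry `i` at position `m` and `1` elsewhere. -/
def phaseUnitary (m : ι) : unitaryGroup ι ℂ :=
  ⟨diagonal (Function.update 1 m Complex.I), by
    rw [mem_unitaryGroup_iff, star_eq_conjTranspose, diagonal_conjTranspose,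
      diagonal_mul_diagonal, ← diagonal_one]
    congr 1
    ext i
    by_cases h : i = m
    · subst h; simp
    · simp [h]⟩

/-- The permutation matrix of `σ` as a unitary, with Mathlib's convention that the entry `(i, j)`
is `1` when `j = σ i`. -/
def permUnitary (σ : Equiv.Perm ι) : unitaryGroup ι ℂ :=
  ⟨σ.permMatrix ℂ, by
    rw [mem_unitaryGroup_iff, star_eq_conjTranspose, conjTranspose_permMatrix, ← permMatrix_mul,
      inv_mul_cancel, permMatrix_one]⟩

/-- A square root of the transposition of `i` and `j`, as a unitary. -/
def sqrtSwapUnitary (i j : ι) : unitaryGroup ι ℂ :=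
  ⟨((1 + Complex.I) / 2) • (1 : Matrix ι ι ℂ) +
      ((1 - Complex.I) / 2) • (permUnitary (Equiv.swap i j) : Matrix ι ι ℂ), by
    have hP : star (permUnitary (Equiv.swap i j) : Matrix ι ι ℂ) =
        permUnitary (Equiv.swap i j) := by
      simp [permUnitary, star_eq_conjTranspose, Equiv.swap_inv]
    have hPP : (permUnitary (Equiv.swap i j) : Matrix ι ι ℂ) *
        permUnitary (Equiv.swap i j) = 1 := by
      simpa only [hP] using mem_unitaryGroup_iff.mp (permUnitary (Equiv.swap i j)).2
    rw [mem_unitaryGroup_iff, star_add, star_smul, star_smul, hP, star_one]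
    simp only [add_mul, mul_add, smul_mul_smul_comm, mul_one, one_mul, hPP]
    simp only [Complex.star_def, map_div₀, map_add, map_sub, map_one, map_ofNat, Complex.conj_I]
    match_scalars
    · linear_combination (-1 / 2 : ℂ) * Complex.I_sq
    · linear_combination (1 / 2 : ℂ) * Complex.I_sq⟩

theorem heisenberg_phaseUnitary_single (m i j : ι) :
    heisenberg (phaseUnitary m : Matrix ι ι ℂ) (single i j 1) =
      (star ((Function.update 1 m Complex.I : ι → ℂ) i) *
        (Function.update 1 m Complex.I : ι → ℂ) j) • single i j 1 := by
  ext a b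
  rw [heisenberg_single]
  by_cases ha : i = a <;> by_cases hb : j = b <;>
    simp [phaseUnitary, ha, hb]

theorem heisenberg_permUnitary_single (σ : Equiv.Perm ι) (i j : ι) :
    heisenberg (permUnitary σ : Matrix ι ι ℂ) (single i j 1) = single (σ i) (σ j) 1 := by
  ext a b
  rw [heisenberg_single]
  by_cases ha : σ i = a <;> by_cases hb : σ j = b <;>
    simp [permUnitary, PEquiv.toMatrix_apply, ha, hb, eq_comm (a := a), eq_comm (a := b)]

theorem heisenberg_sqrtSwapUnitary_single (i j : ι) :
    heisenberg (sqrtSwapUnitary i j : Matrix ι ι ℂ) (single i i 1) =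
      (1 / 2 : ℂ) • (single i i 1 + single j j 1 + Complex.I • (single j i 1 - single i j 1)) := by
  ext a b
  have hrow (c : ι) : (sqrtSwapUnitary i j : Matrix ι ι ℂ) i c =
      (1 + Complex.I) / 2 * (if i = c then 1 else 0) +
        (1 - Complex.I) / 2 * (if j = c then 1 else 0) := by
    simp [sqrtSwapUnitary, permUnitary, PEquiv.toMatrix_apply, one_apply]
  have hunit (k l : ι) : single k l (1 : ℂ) a b =
      (if k = a then 1 else 0) * (if l = b then 1 else 0) := by
    rw [single_apply, ite_and, ite_mul, one_mul, zero_mul]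
  simp only [heisenberg_single, of_apply, hrow, Matrix.smul_apply, Matrix.add_apply,
    Matrix.sub_apply, hunit, star_add, star_mul', Complex.star_def, map_div₀, map_add, map_sub,
    map_one, map_ofNat, Complex.conj_I, apply_ite (starRingEnd ℂ), map_zero, smul_eq_mul]
  generalize (if i = a then (1 : ℂ) else 0) = x, (if j = a then (1 : ℂ) else 0) = y,
    (if i = b then (1 : ℂ) else 0) = z, (if j = b then (1 : ℂ) else 0) = w
  linear_combination ((x - y) * (w - z) / 4) * Complex.I_sq

/-- Invariance of a sesquilinear form on matrices under the simultaneous conjugation of both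
arguments by a unitary. -/
def IsConjInvariant (Q : Matrix ι ι ℂ →ₗ⋆[ℂ] Matrix ι ι ℂ →ₗ[ℂ] ℂ) : Prop :=
  ∀ (U : unitaryGroup ι ℂ) (A B : Matrix ι ι ℂ),
    Q (heisenberg (U : Matrix ι ι ℂ) A) (heisenberg (U : Matrix ι ι ℂ) B) = Q A B

namespace IsConjInvariant

variable {Q : Matrix ι ι ℂ →ₗ⋆[ℂ] Matrix ι ι ℂ →ₗ[ℂ] ℂ}

theorem single_single_perm (hQ : IsConjInvariant Q) (σ : Equiv.Perm ι) (i j k l : ι) :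
    Q (single (σ i) (σ j) 1) (single (σ k) (σ l) 1) = Q (single i j 1) (single k l 1) := by
  simpa only [heisenberg_permUnitary_single] using hQ (permUnitary σ) (single i j 1) (single k l 1)

theorem single_single_eq_zero (hQ : IsConjInvariant Q) {i j k l : ι}
    (h₁ : ¬ (i = j ∧ k = l)) (h₂ : ¬ (i = k ∧ j = l)) :
    Q (single i j 1) (single k l 1) = 0 := by
  by_contra hT
  have hphase (m : ι) : (Function.update 1 m Complex.I : ι → ℂ) i *
      star ((Function.update 1 m Complex.I : ι → ℂ) j) *
      (star ((Function.update 1 m Complex.I : ι → ℂ) k) *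
        (Function.update 1 m Complex.I : ι → ℂ) l) = 1 := by
    have h := hQ (phaseUnitary m) (single i j 1) (single k l 1)
    rw [heisenberg_phaseUnitary_single, heisenberg_phaseUnitary_single] at h
    simp only [map_smulₛₗ, LinearMap.smul_apply, smul_eq_mul, RingHom.id_apply] at h
    refine mul_right_cancel₀ hT (Eq.trans ?_ (h.trans (one_mul _).symm))
    rw [map_mul, starRingEnd_apply, star_star, starRingEnd_apply]
    ring
  have hI : Complex.I ≠ 1 := fun h => by simpa using congrArg Complex.im h
  have hnegI : -Complex.I ≠ 1 := fun h => by simpa using congrArg Complex.im h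
  have hneg : (-1 : ℂ) ≠ 1 := by norm_num
  rcases eq_or_ne i j with rfl | hij
  · have hkl : k ≠ l := fun h => h₁ ⟨rfl, h⟩
    have := hphase l
    rcases eq_or_ne i l with rfl | hil <;> simp_all
  · rcases eq_or_ne i k with rfl | hik
    · have hlj : l ≠ j := fun h => h₂ ⟨rfl, h.symm⟩
      have := hphase j
      simp_all
    · have := hphase i
      rcases eq_or_ne l i with rfl | hli <;> simp_all [hij.symm, hik.symm]

/-- The coefficients of the diagonal matrix units are matched through the square root of a swap,
which maps the matrix unit `(i, i)` to an even mixture of the matrix units on `{i, j}`. -/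
theorem single_single_self (hQ : IsConjInvariant Q) {i j : ι} (hij : i ≠ j) :
    Q (single i i 1) (single i i 1) =
      Q (single i i 1) (single j j 1) + Q (single i j 1) (single i j 1) := by
  have hrot := hQ (sqrtSwapUnitary i j) (single i i 1) (single i i 1)
  have hzero {a b c e : ι} := hQ.single_single_eq_zero (i := a) (j := b) (k := c) (l := e)
  have hswap (a b c e : ι) := hQ.single_single_perm (Equiv.swap i j) a b c e
  have hjj := hswap i i i i
  have hji := hswap i j i j
  have hjjii := hswap i i j j
  rw [heisenberg_sqrtSwapUnitary_single] at hrot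
  simp only [Equiv.swap_apply_left, Equiv.swap_apply_right] at hjj hji hjjii
  simp only [map_smulₛₗ, map_add, map_sub, LinearMap.add_apply, LinearMap.sub_apply,
    LinearMap.smul_apply, smul_eq_mul, RingHom.id_apply, map_div₀, map_one, map_ofNat,
    Complex.conj_I, hjj, hji, hjjii] at hrot
  simp only [hij.symm, and_true, not_false_eq_true, hzero, hij, and_false, sub_self, mul_zero,
    add_zero, and_self, sub_zero, neg_mul, zero_add, mul_neg, zero_sub, neg_neg] at hrot
  linear_combination (-2) * hrot - Q (single i j 1) (single i j 1) * Complex.I_sq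

theorem exists_single_single_eq [Nontrivial ι] (hQ : IsConjInvariant Q) :
    ∃ α β : ℂ, ∀ i j k l, Q (single i j 1) (single k l 1) =
      α * (if i = j ∧ k = l then 1 else 0) + β * (if i = k ∧ j = l then 1 else 0) := by
  obtain ⟨i₀, j₀, h₀⟩ := exists_pair_ne ι
  refine ⟨Q (single i₀ i₀ 1) (single j₀ j₀ 1), Q (single i₀ j₀ 1) (single i₀ j₀ 1),
    fun i j k l => ?_⟩
  have htrans {a b : ι} (hab : a ≠ b) : ∃ σ : Equiv.Perm ι, σ i₀ = a ∧ σ j₀ = b := by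
    have hmove : Equiv.swap i₀ a j₀ ≠ a := fun h => by
      rw [Equiv.swap_apply_eq_iff, Equiv.swap_apply_right] at h
      exact h₀ h.symm
    refine ⟨(Equiv.swap i₀ a).trans (Equiv.swap (Equiv.swap i₀ a j₀) b), ?_, ?_⟩
    · rw [Equiv.trans_apply, Equiv.swap_apply_left, Equiv.swap_apply_of_ne_of_ne hmove.symm hab]
    · rw [Equiv.trans_apply, Equiv.swap_apply_left]
  by_cases h₁ : i = j ∧ k = l
  · obtain ⟨rfl, rfl⟩ := h₁
    rcases eq_or_ne i k with rfl | hik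
    · have := hQ.single_single_perm (Equiv.swap i₀ i) i₀ i₀ i₀ i₀
      rw [Equiv.swap_apply_left] at this
      simp [this, hQ.single_single_self h₀]
    · obtain ⟨σ, rfl, rfl⟩ := htrans hik
      simp [hQ.single_single_perm, hik]
  · by_cases h₂ : i = k ∧ j = l
    · obtain ⟨rfl, rfl⟩ := h₂
      have hij : i ≠ j := fun h => h₁ ⟨h, h⟩
      obtain ⟨σ, rfl, rfl⟩ := htrans hij
      simp [hQ.single_single_perm, hij]
    · simp [hQ.single_single_eq_zero h₁ h₂, h₁, h₂]

theorem exists_apply_eq [Nontrivial ι] (hQ : IsConjInvariant Q) :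
    ∃ α β : ℂ, ∀ A B : Matrix ι ι ℂ,
      Q A B = α * (star A.trace * B.trace) + β * (Aᴴ * B).trace := by
  obtain ⟨α, β, h⟩ := hQ.exists_single_single_eq
  refine ⟨α, β, fun A B => ?_⟩
  calc Q A B = ∑ i, ∑ k, star (A i i) * (α * B k k) + ∑ i, ∑ j, star (A i j) * (β * B i j) := by
        simp [sesqForm_apply_eq_sum Q A B, h, mul_add, add_mul, Finset.sum_add_distrib, ite_and,
          Finset.sum_mul, mul_comm]
    _ = _ := by
        simp only [trace, diag_apply, mul_apply, conjTranspose_apply, star_sum]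
        rw [Finset.sum_mul_sum]
        simp only [Finset.mul_sum]
        congr 1
        · simp only [mul_left_comm]
        · rw [Finset.sum_comm]
          simp only [mul_left_comm]

end IsConjInvariant

end InvariantForms

section HilbertSchmidtBases

variable {ι κ : Type*} [Fintype ι] [DecidableEq ι] [Fintype κ] [DecidableEq κ]

omit [DecidableEq ι] in
theorem dotProduct_star_self (v : ι → ℂ) : v ⬝ᵥ star v = ((∑ i, ‖v i‖ ^ 2 : ℝ) : ℂ) := by
  simp only [dotProduct, Pi.star_apply, Complex.star_def, Complex.mul_conj', Complex.ofReal_sum,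
    Complex.ofReal_pow]

/-- A basis of the matrices, orthogonal for the Hilbert–Schmidt inner product and normalized like
the unitary matrices. -/
structure IsHilbertSchmidtBasis (F : κ → Matrix ι ι ℂ) : Prop where
  card_eq : Fintype.card κ = Fintype.card ι ^ 2
  trace_eq : ∀ a b, ((F a)ᴴ * F b).trace = if a = b then (Fintype.card ι : ℂ) else 0

namespace IsHilbertSchmidtBasis

variable {F : κ → Matrix ι ι ℂ}

/-- The matrix `E` of the coordinates is square, so `Eᴴ * E` being scalar makes `E * Eᴴ` scalar,
and the identity is Parseval's. -/
theorem sum_norm_sq_eq [Nonempty ι] (hF : IsHilbertSchmidtBasis F) (L : Matrix ι ι ℂ →ₗ[ℂ] ℂ) :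
    ∑ k, ‖L (F k)‖ ^ 2 = Fintype.card ι * ∑ i, ∑ j, ‖L (single i j 1)‖ ^ 2 := by
  have hN : (Fintype.card ι : ℂ) ≠ 0 := Nat.cast_ne_zero.mpr Fintype.card_ne_zero
  let E : Matrix (ι × ι) κ ℂ := of fun p k => F k p.1 p.2
  let v : ι × ι → ℂ := fun p => L (single p.1 p.2 1)
  have hEE : Eᴴ * E = (Fintype.card ι : ℂ) • 1 := by
    ext a b
    have h := hF.trace_eq a b
    simp only [trace, diag_apply, mul_apply, conjTranspose_apply] at h
    rw [Finset.sum_comm] at h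
    simpa [mul_apply, E, Fintype.sum_prod_type, one_apply] using h
  have hEE' : E * Eᴴ = (Fintype.card ι : ℂ) • 1 := by
    have hinv : ((Fintype.card ι : ℂ)⁻¹ • Eᴴ) * E = 1 := by
      rw [smul_mul, hEE, inv_smul_smul₀ hN]
    rwa [mul_eq_one_comm_of_card_eq _ _ _ (by rw [hF.card_eq, Fintype.card_prod, sq]),
      Matrix.mul_smul, inv_smul_eq_iff₀ hN] at hinv
  have hv : (fun k => L (F k)) = v ᵥ* E := by
    ext k
    conv_lhs => rw [matrix_eq_sum_smul_single (F k)]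
    simp only [map_sum, map_smul, smul_eq_mul, vecMul, dotProduct, Fintype.sum_prod_type, v, E,
      of_apply, mul_comm]
  have hparseval : (fun k => L (F k)) ⬝ᵥ star (fun k => L (F k)) =
      (Fintype.card ι : ℂ) * (v ⬝ᵥ star v) := by
    rw [hv, star_vecMul, ← dotProduct_mulVec, mulVec_mulVec, hEE', smul_mulVec, one_mulVec,
      dotProduct_smul, smul_eq_mul]
  rw [dotProduct_star_self, dotProduct_star_self] at hparseval
  rw [← Fintype.sum_prod_type']
  exact_mod_cast hparseval

theorem heisenberg (hF : IsHilbertSchmidtBasis F) (U : unitaryGroup ι ℂ) :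
    IsHilbertSchmidtBasis fun k => heisenberg (U : Matrix ι ι ℂ) (F k) where
  card_eq := hF.card_eq
  trace_eq a b := by
    rw [conjTranspose_heisenberg, heisenberg_mul_heisenberg, trace_heisenberg, hF.trace_eq]

theorem sum_norm_sq_heisenberg [Nonempty ι] (hF : IsHilbertSchmidtBasis F) (U : unitaryGroup ι ℂ)
    (L : Matrix ι ι ℂ →ₗ[ℂ] ℂ) :
    ∑ k, ‖L (VariationalCircuit.heisenberg (U : Matrix ι ι ℂ) (F k))‖ ^ 2 = ∑ k, ‖L (F k)‖ ^ 2 := by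
  rw [(hF.heisenberg U).sum_norm_sq_eq, hF.sum_norm_sq_eq]

theorem sum_erase_norm_sq_heisenberg [Nonempty ι] (hF : IsHilbertSchmidtBasis F) {k₀ : κ}
    (hk₀ : F k₀ = 1) (U : unitaryGroup ι ℂ) (L : Matrix ι ι ℂ →ₗ[ℂ] ℂ) :
    ∑ k ∈ Finset.univ.erase k₀, ‖L (VariationalCircuit.heisenberg (U : Matrix ι ι ℂ) (F k))‖ ^ 2 =
      ∑ k ∈ Finset.univ.erase k₀, ‖L (F k)‖ ^ 2 := by
  have hall := hF.sum_norm_sq_heisenberg U L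
  rwa [← Finset.add_sum_erase _ _ (Finset.mem_univ k₀),
    ← Finset.add_sum_erase _ _ (Finset.mem_univ k₀), hk₀, heisenberg_one, add_right_inj] at hall

omit [DecidableEq ι] in
theorem kronecker {ι' κ' : Type*} [Fintype ι'] [Fintype κ'] [DecidableEq κ']
    {G : κ' → Matrix ι' ι' ℂ} (hF : IsHilbertSchmidtBasis F) (hG : IsHilbertSchmidtBasis G) :
    IsHilbertSchmidtBasis fun k : κ × κ' => F k.1 ⊗ₖ G k.2 where
  card_eq := by simp only [Fintype.card_prod, hF.card_eq, hG.card_eq, mul_pow]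
  trace_eq a b := by
    simp only [conjTranspose_kronecker, ← mul_kronecker_mul, trace_kronecker, hF.trace_eq,
      hG.trace_eq, Prod.ext_iff, ite_and, ite_mul, zero_mul, mul_ite, mul_zero,
      Fintype.card_prod, Nat.cast_mul]
    split_ifs <;> rfl

end IsHilbertSchmidtBasis

/-- The nonconstant elements of the basis are traceless, so the form is a multiple of the
Hilbert–Schmidt inner product on them. -/
theorem IsConjInvariant.mul_apply_self_eq_sum [Nontrivial ι]
    {Q : Matrix ι ι ℂ →ₗ⋆[ℂ] Matrix ι ι ℂ →ₗ[ℂ] ℂ} (hQ : IsConjInvariant Q) {F : κ → Matrix ι ι ℂ}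
    (hF : IsHilbertSchmidtBasis F) {k₀ r : κ} (hk₀ : F k₀ = 1) (hr : r ≠ k₀) :
    ((Fintype.card ι : ℂ) ^ 2 - 1) * Q (F r) (F r) =
      ∑ k ∈ Finset.univ.erase k₀, Q (F k) (F k) := by
  obtain ⟨α, β, h⟩ := hQ.exists_apply_eq
  have hdiag (k : κ) (hk : k ≠ k₀) : Q (F k) (F k) = β * Fintype.card ι := by
    have htrace : (F k).trace = 0 := by
      simpa [hk₀, hk.symm] using hF.trace_eq k₀ k
    rw [h, htrace, hF.trace_eq, if_pos rfl, mul_zero, mul_zero, zero_add]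
  rw [hdiag r hr, Finset.sum_congr rfl fun k hk => hdiag k (Finset.ne_of_mem_erase hk),
    Finset.sum_const, Finset.card_erase_of_mem (Finset.mem_univ _), Finset.card_univ, hF.card_eq,
    nsmul_eq_mul, Nat.cast_sub (Nat.one_le_pow _ _ Fintype.card_pos)]
  push_cast
  rfl

end HilbertSchmidtBases

section SecondMoments

variable {ι : Type*} [Fintype ι] [DecidableEq ι]

instance instSecondCountableTopologyUnitaryGroup :
    SecondCountableTopology (unitaryGroup ι ℂ) :=
  haveI : SecondCountableTopology (Matrix ι ι ℂ) :=
    inferInstanceAs (SecondCountableTopology (ι → ι → ℂ))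
  TopologicalSpace.Subtype.secondCountableTopology _

instance instIsHaarMeasureHaarUnitary : (haarUnitary ι).IsHaarMeasure := by
  unfold haarUnitary; infer_instance

instance instIsProbabilityMeasureHaarUnitary : IsProbabilityMeasure (haarUnitary ι) where
  measure_univ := by
    simpa [haarUnitary] using Measure.haarMeasure_self
      (K₀ := (⊤ : TopologicalSpace.PositiveCompacts (unitaryGroup ι ℂ)))

theorem integrable_of_continuous_compact {X E : Type*} [TopologicalSpace X] [CompactSpace X]
    [MeasurableSpace X] [OpensMeasurableSpace X] [NormedAddCommGroup E]
    (μ : Measure X) [IsFiniteMeasure μ] {f : X → E} (hf : Continuous f) : Integrable f μ :=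
  hf.integrable_of_hasCompactSupport (HasCompactSupport.of_compactSpace f)

theorem continuous_apply_heisenberg (L : Matrix ι ι ℂ →ₗ[ℂ] ℂ) (A : Matrix ι ι ℂ) :
    Continuous fun V : unitaryGroup ι ℂ => L (heisenberg (V : Matrix ι ι ℂ) A) :=
  L.continuous_of_finiteDimensional.comp ((continuous_heisenberg A).comp continuous_subtype_val)

theorem integrable_star_mul_heisenberg (μ : Measure (unitaryGroup ι ℂ)) [IsFiniteMeasure μ]
    (L : Matrix ι ι ℂ →ₗ[ℂ] ℂ) (A B : Matrix ι ι ℂ) :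
    Integrable (fun V : unitaryGroup ι ℂ => star (L (heisenberg (V : Matrix ι ι ℂ) A)) *
      L (heisenberg (V : Matrix ι ι ℂ) B)) μ :=
  integrable_of_continuous_compact μ
    ((continuous_apply_heisenberg L A).star.mul (continuous_apply_heisenberg L B))

/-- The second moments, under the random unitary `V` of law `μ`, of the values of the functional
`L` on the observables evolved by `V`. -/
def secondMoment (μ : Measure (unitaryGroup ι ℂ)) [IsFiniteMeasure μ] (L : Matrix ι ι ℂ →ₗ[ℂ] ℂ) :
    Matrix ι ι ℂ →ₗ⋆[ℂ] Matrix ι ι ℂ →ₗ[ℂ] ℂ :=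
  LinearMap.mk₂'ₛₗ (starRingEnd ℂ) (RingHom.id ℂ)
    (fun A B => ∫ V : unitaryGroup ι ℂ, star (L (heisenberg (V : Matrix ι ι ℂ) A)) *
      L (heisenberg (V : Matrix ι ι ℂ) B) ∂μ)
    (fun A A' B => by
      simp only [map_add, star_add, add_mul]
      exact integral_add (integrable_star_mul_heisenberg μ L A B)
        (integrable_star_mul_heisenberg μ L A' B))
    (fun c A B => by
      simp only [map_smul, smul_eq_mul, star_mul', mul_assoc, starRingEnd_apply]
      exact integral_const_mul _ _)
    (fun A B B' => by
      simp only [map_add, mul_add]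
      exact integral_add (integrable_star_mul_heisenberg μ L A B)
        (integrable_star_mul_heisenberg μ L A B'))
    (fun c A B => by
      simp only [map_smul, smul_eq_mul, mul_left_comm, RingHom.id_apply]
      exact integral_const_mul _ _)

theorem secondMoment_apply (μ : Measure (unitaryGroup ι ℂ)) [IsFiniteMeasure μ]
    (L : Matrix ι ι ℂ →ₗ[ℂ] ℂ) (A B : Matrix ι ι ℂ) :
    secondMoment μ L A B = ∫ V : unitaryGroup ι ℂ, star (L (heisenberg (V : Matrix ι ι ℂ) A)) *
      L (heisenberg (V : Matrix ι ι ℂ) B) ∂μ := rfl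

theorem secondMoment_apply_self (μ : Measure (unitaryGroup ι ℂ)) [IsFiniteMeasure μ]
    (L : Matrix ι ι ℂ →ₗ[ℂ] ℂ) (A : Matrix ι ι ℂ) :
    secondMoment μ L A A =
      (∫ V : unitaryGroup ι ℂ, ‖L (heisenberg (V : Matrix ι ι ℂ) A)‖ ^ 2 ∂μ : ℝ) := by
  rw [secondMoment_apply, ← integral_complex_ofReal]
  exact integral_congr_ae (.of_forall fun V => by
    simp only [Complex.star_def, Complex.conj_mul', Complex.ofReal_pow])

theorem isConjInvariant_secondMoment (μ : Measure (unitaryGroup ι ℂ)) [IsFiniteMeasure μ]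
    [μ.IsMulLeftInvariant] (L : Matrix ι ι ℂ →ₗ[ℂ] ℂ) : IsConjInvariant (secondMoment μ L) := by
  intro U A B
  simp only [secondMoment_apply, ← heisenberg_mul]
  exact integral_mul_left_eq_self (μ := μ) (fun V : unitaryGroup ι ℂ =>
    star (L (heisenberg (V : Matrix ι ι ℂ) A)) * L (heisenberg (V : Matrix ι ι ℂ) B)) U

theorem apply_heisenberg_single (L : Matrix ι ι ℂ →ₗ[ℂ] ℂ) (U : Matrix ι ι ℂ) (i j : ι) :
    L (heisenberg U (single i j 1)) =
      ∑ p : ι × ι, star (U i p.1) * U j p.2 * L (single p.1 p.2 1) := by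
  rw [matrix_eq_sum_smul_single (heisenberg _ _), heisenberg_single, Fintype.sum_prod_type]
  simp only [map_sum, map_smul, smul_eq_mul, of_apply]

theorem secondMoment_single_single (μ : Measure (unitaryGroup ι ℂ)) [IsFiniteMeasure μ]
    (L : Matrix ι ι ℂ →ₗ[ℂ] ℂ) (i j k l : ι) :
    secondMoment μ L (single i j 1) (single k l 1) =
      ∑ p : ι × ι, ∑ r : ι × ι, star (L (single p.1 p.2 1)) * L (single r.1 r.2 1) *
        ∫ V : unitaryGroup ι ℂ, (V : Matrix ι ι ℂ) i p.1 * (V : Matrix ι ι ℂ) l r.2 *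
          star ((V : Matrix ι ι ℂ) j p.2) * star ((V : Matrix ι ι ℂ) k r.1) ∂μ := by
  have hentry (a b : ι) : Continuous fun V : unitaryGroup ι ℂ => (V : Matrix ι ι ℂ) a b :=
    (continuous_apply_apply a b).comp continuous_subtype_val
  have hint (p r : ι × ι) : Integrable (fun V : unitaryGroup ι ℂ =>
      star (L (single p.1 p.2 1)) * L (single r.1 r.2 1) * ((V : Matrix ι ι ℂ) i p.1 *
        (V : Matrix ι ι ℂ) l r.2 * star ((V : Matrix ι ι ℂ) j p.2) *
          star ((V : Matrix ι ι ℂ) k r.1))) μ :=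
    integrable_of_continuous_compact μ <| continuous_const.mul <|
      (((hentry i _).mul (hentry l _)).mul (hentry j _).star).mul (hentry k _).star
  simp only [← integral_const_mul, secondMoment_apply, ← integral_finsetSum _ fun r _ => hint _ r,
    ← integral_finsetSum _ fun p _ => integrable_finsetSum _ fun r _ => hint p r]
  congr with V
  rw [apply_heisenberg_single, apply_heisenberg_single, star_sum, Finset.sum_mul_sum]
  refine Finset.sum_congr rfl fun p _ => Finset.sum_congr rfl fun r _ => ?_
  simp only [star_mul', star_star]
  ring

theorem IsTwoDesign.secondMoment_eq {μ : Measure (unitaryGroup ι ℂ)} [IsFiniteMeasure μ]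
    (hμ : IsTwoDesign μ) (L : Matrix ι ι ℂ →ₗ[ℂ] ℂ) :
    secondMoment μ L = secondMoment (haarUnitary ι) L := by
  ext A B
  simp only [sesqForm_apply_eq_sum _ A B, secondMoment_single_single, hμ.moments]

theorem IsTwoDesign.isConjInvariant_secondMoment {μ : Measure (unitaryGroup ι ℂ)}
    [IsFiniteMeasure μ] (hμ : IsTwoDesign μ) (L : Matrix ι ι ℂ →ₗ[ℂ] ℂ) :
    IsConjInvariant (secondMoment μ L) := by
  rw [hμ.secondMoment_eq L]
  exact VariationalCircuit.isConjInvariant_secondMoment (haarUnitary ι) L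

end SecondMoments

section Mixing

variable {ι κ : Type*} [Fintype ι] [DecidableEq ι] [Nontrivial ι] [Fintype κ] [DecidableEq κ]
  {μ : Measure (unitaryGroup ι ℂ)} {F : κ → Matrix ι ι ℂ} {k₀ r : κ}

theorem IsTwoDesign.integral_norm_sq (hμ : IsTwoDesign μ) (hF : IsHilbertSchmidtBasis F)
    (hk₀ : F k₀ = 1) (hr : r ≠ k₀) (L : Matrix ι ι ℂ →ₗ[ℂ] ℂ) :
    ∫ V : unitaryGroup ι ℂ, ‖L (heisenberg (V : Matrix ι ι ℂ) (F r))‖ ^ 2 ∂μ =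
      (∑ k ∈ Finset.univ.erase k₀, ‖L (F k)‖ ^ 2) / ((Fintype.card ι : ℝ) ^ 2 - 1) := by
  have := hμ.isProbabilityMeasure
  have hcard : (1 : ℝ) < Fintype.card ι := by exact_mod_cast Fintype.one_lt_card
  have hmix := (hμ.isConjInvariant_secondMoment L).mul_apply_self_eq_sum hF hk₀ hr
  simp only [secondMoment_apply_self] at hmix
  have hsum : ∑ k ∈ Finset.univ.erase k₀,
      ∫ V : unitaryGroup ι ℂ, ‖L (heisenberg (V : Matrix ι ι ℂ) (F k))‖ ^ 2 ∂μ =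
        ∑ k ∈ Finset.univ.erase k₀, ‖L (F k)‖ ^ 2 := by
    have hint (k : κ) : Integrable
        (fun V : unitaryGroup ι ℂ => ‖L (heisenberg (V : Matrix ι ι ℂ) (F k))‖ ^ 2) μ :=
      integrable_of_continuous_compact μ ((continuous_apply_heisenberg L (F k)).norm.pow 2)
    rw [← integral_finsetSum _ fun k _ => hint k]
    simp only [hF.sum_erase_norm_sq_heisenberg hk₀, integral_const, probReal_univ, one_smul]
  rw [eq_div_iff (by nlinarith), mul_comm, ← hsum]
  exact_mod_cast hmix

theorem IsTwoDesign.integral_norm_sq_mul_mul (hμ : IsTwoDesign μ) (hF : IsHilbertSchmidtBasis F)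
    (hk₀ : F k₀ = 1) (hr : r ≠ k₀) (L : Matrix ι ι ℂ →ₗ[ℂ] ℂ) (S T : unitaryGroup ι ℂ) :
    ∫ V : unitaryGroup ι ℂ, ‖L (heisenberg (S * V * T : Matrix ι ι ℂ) (F r))‖ ^ 2 ∂μ =
      (∑ k ∈ Finset.univ.erase k₀, ‖L (F k)‖ ^ 2) / ((Fintype.card ι : ℝ) ^ 2 - 1) := by
  have hstep := hμ.integral_norm_sq (hF.heisenberg S) (hk₀ ▸ heisenberg_one S) hr
    (L ∘ₗ heisenberg (T : Matrix ι ι ℂ))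
  simp only [LinearMap.comp_apply, ← heisenberg_mul] at hstep
  rw [hstep, ← hF.sum_erase_norm_sq_heisenberg hk₀ (S * T) L]
  rfl

end Mixing

section OperatorBases

variable {q : ℕ} [NeZero q] {M : Fin (q ^ 2) → Matrix (Fin q) (Fin q) ℂ}

namespace IsOperatorBasis

theorem isHilbertSchmidtBasis (hM : IsOperatorBasis M) : IsHilbertSchmidtBasis M where
  card_eq := by simp only [Fintype.card_fin]
  trace_eq a b := by rw [hM.trace_eq, Fintype.card_fin]

theorem sum_norm_sq_apply_zero (hM : IsOperatorBasis M) : ∑ a, ‖M a 0 0‖ ^ 2 = (q : ℝ) := by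
  have h := hM.isHilbertSchmidtBasis.sum_norm_sq_eq (Matrix.entryLinearMap ℂ ℂ 0 0)
  simpa [single_apply, ite_and, apply_ite] using h

theorem integral_norm_sq_kronecker (hM : IsOperatorBasis M) (hq : 2 ≤ q)
    {ν : Measure (unitaryGroup (Fin q × Fin q) ℂ)} (hν : IsTwoDesign ν)
    {r : Fin (q ^ 2) × Fin (q ^ 2)} (hr : r ≠ 0) (L : PairOp q →ₗ[ℂ] ℂ)
    (S T : unitaryGroup (Fin q × Fin q) ℂ) :
    ∫ V : unitaryGroup (Fin q × Fin q) ℂ,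
        ‖L (heisenberg (S * V * T : PairOp q) (M r.1 ⊗ₖ M r.2))‖ ^ 2 ∂ν =
      (∑ k ∈ Finset.univ.erase (0 : Fin (q ^ 2) × Fin (q ^ 2)), ‖L (M k.1 ⊗ₖ M k.2)‖ ^ 2) /
        ((q : ℝ) ^ 4 - 1) := by
  have := Fin.nontrivial_iff_two_le.mpr hq
  have hzero : M (0 : Fin (q ^ 2) × Fin (q ^ 2)).1 ⊗ₖ M (0 : Fin (q ^ 2) × Fin (q ^ 2)).2 = 1 := by
    simp only [Prod.fst_zero, Prod.snd_zero, hM.zero_eq_one, one_kronecker_one]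
  rw [hν.integral_norm_sq_mul_mul (hM.isHilbertSchmidtBasis.kronecker hM.isHilbertSchmidtBasis)
    hzero hr L S T]
  congr 2
  rw [Fintype.card_prod, Fintype.card_fin]
  push_cast
  ring

end IsOperatorBasis

end OperatorBases

section Sites

variable {q n : ℕ}

/-- The splitting of a configuration into its values at `i`, `j` and on the other sites. -/
def splitPair (q : ℕ) {i j : Fin n} (h : i ≠ j) :
    (Fin n → Fin q) ≃ (Fin q × Fin q) × ({l : Fin n // l ≠ i ∧ l ≠ j} → Fin q) where
  toFun s := ((s i, s j), fun l => s l)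
  invFun p := fun l => if hi : l = i then p.1.1 else if hj : l = j then p.1.2 else p.2 ⟨l, hi, hj⟩
  left_inv s := by
    ext l
    by_cases hi : l = i
    · simp [hi]
    · by_cases hj : l = j
      · subst hj; simp [hi]
      · simp [hi, hj]
  right_inv p := by
    ext l
    · simp
    · simp [h.symm]
    · simp [l.2.1, l.2.2]

theorem onPair_eq_submatrix {i j : Fin n} (h : i ≠ j) (G : PairOp q) :
    onPair i j G = (G ⊗ₖ (1 : Matrix ({l : Fin n // l ≠ i ∧ l ≠ j} → Fin q) _ ℂ)).submatrix
      (splitPair q h) (splitPair q h) := by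
  ext s t
  simp only [onPair, splitPair, Equiv.coe_fn_mk, of_apply, submatrix_apply, kroneckerMap_apply,
    one_apply, mul_ite, mul_one, mul_zero, funext_iff, Subtype.forall, and_imp]

/-- The tensor product of the `M (x l)` over the sites other than `i`, `j`. -/
def restOp (M : Fin (q ^ 2) → Matrix (Fin q) (Fin q) ℂ) (x : Fin n → Fin (q ^ 2)) (i j : Fin n) :
    Matrix ({l : Fin n // l ≠ i ∧ l ≠ j} → Fin q) ({l : Fin n // l ≠ i ∧ l ≠ j} → Fin q) ℂ :=
  of fun s t => ∏ l : {l : Fin n // l ≠ i ∧ l ≠ j}, M (x l) (s l) (t l)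

/-- The operator acting as `X` on the pair of sites `i`, `j` and as `M_x` on the other sites, as a
linear function of `X`. -/
def tensorOpWith {i j : Fin n} (h : i ≠ j) (M : Fin (q ^ 2) → Matrix (Fin q) (Fin q) ℂ)
    (x : Fin n → Fin (q ^ 2)) : PairOp q →ₗ[ℂ] Op q n where
  toFun X := (X ⊗ₖ restOp M x i j).submatrix (splitPair q h) (splitPair q h)
  map_add' X Y := by rw [add_kronecker, submatrix_add]; rfl
  map_smul' c X := by rw [smul_kronecker, submatrix_smul]; rfl

theorem prod_eq_mul_mul_prod {R : Type*} [CommMonoid R] {i j : Fin n} (h : i ≠ j) (f : Fin n → R) :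
    ∏ l, f l = f i * f j * ∏ l : {l : Fin n // l ≠ i ∧ l ≠ j}, f l := by
  rw [← Finset.mul_prod_erase _ f (Finset.mem_univ i),
    ← Finset.mul_prod_erase _ f (Finset.mem_erase.mpr ⟨h.symm, Finset.mem_univ j⟩), ← mul_assoc]
  congr 1
  exact Finset.prod_subtype _ (by simp [and_comm]) f

theorem tensorOp_eq_tensorOpWith {i j : Fin n} (h : i ≠ j)
    (M : Fin (q ^ 2) → Matrix (Fin q) (Fin q) ℂ) (x : Fin n → Fin (q ^ 2)) :
    tensorOp M x = tensorOpWith h M x (M (x i) ⊗ₖ M (x j)) := by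
  ext s t
  simp [tensorOp, tensorOpWith, restOp, splitPair, prod_eq_mul_mul_prod h]

theorem heisenberg_onPair_tensorOpWith {i j : Fin n} (h : i ≠ j)
    (M : Fin (q ^ 2) → Matrix (Fin q) (Fin q) ℂ) (x : Fin n → Fin (q ^ 2)) (W X : PairOp q) :
    heisenberg (onPair i j W) (tensorOpWith h M x X) = tensorOpWith h M x (heisenberg W X) := by
  simp only [heisenberg_apply, tensorOpWith, LinearMap.coe_mk, AddHom.coe_mk,
    onPair_eq_submatrix h, conjTranspose_submatrix, submatrix_mul_equiv, conjTranspose_kronecker,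
    conjTranspose_one, ← mul_kronecker_mul, Matrix.one_mul, Matrix.mul_one]

/-- The configuration obtained from `x` by replacing the entries at `i` and `j` by those of `r`. -/
def setPair {β : Type*} (x : Fin n → β) (i j : Fin n) (r : β × β) : Fin n → β :=
  Function.update (Function.update x i r.1) j r.2

section SetPair

variable {β : Type*} (x : Fin n → β) {i j : Fin n} (r : β × β)

theorem setPair_fst (h : i ≠ j) : setPair x i j r i = r.1 := by
  rw [setPair, Function.update_of_ne h, Function.update_self]

theorem setPair_snd : setPair x i j r j = r.2 := Function.update_self ..

theorem setPair_of_ne {l : Fin n} (hi : l ≠ i) (hj : l ≠ j) : setPair x i j r l = x l := by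
  rw [setPair, Function.update_of_ne hj, Function.update_of_ne hi]

end SetPair

theorem tensorOpWith_kronecker {i j : Fin n} (h : i ≠ j)
    (M : Fin (q ^ 2) → Matrix (Fin q) (Fin q) ℂ) (x : Fin n → Fin (q ^ 2))
    (r : Fin (q ^ 2) × Fin (q ^ 2)) :
    tensorOpWith h M x (M r.1 ⊗ₖ M r.2) = tensorOp M (setPair x i j r) := by
  have hrest : restOp M (setPair x i j r) i j = restOp M x i j := by
    ext s t
    have hentry (l : {l : Fin n // l ≠ i ∧ l ≠ j}) : setPair x i j r l = x l :=
      setPair_of_ne x r l.2.1 l.2.2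
    simp only [restOp, of_apply, hentry]
  rw [tensorOp_eq_tensorOpWith h, setPair_fst x r h, setPair_snd]
  simp only [tensorOpWith, hrest]

theorem onPair_mem_unitaryGroup {i j : Fin n} (h : i ≠ j) {G : PairOp q}
    (hG : G ∈ unitaryGroup (Fin q × Fin q) ℂ) :
    onPair i j G ∈ unitaryGroup (Fin n → Fin q) ℂ := by
  rw [mem_unitaryGroup_iff, star_eq_conjTranspose] at *
  rw [onPair_eq_submatrix h, conjTranspose_submatrix, submatrix_mul_equiv,
    conjTranspose_kronecker, ← mul_kronecker_mul, hG]
  simp only [conjTranspose_one, mul_one, one_kronecker_one, submatrix_one_equiv]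

theorem continuous_onPair (i j : Fin n) : Continuous (onPair i j : PairOp q → Op q n) := by
  refine continuous_matrix fun s t => ?_
  by_cases h : ∀ l, l ≠ i → l ≠ j → s l = t l
  · simp only [onPair, of_apply, if_pos h]
    exact continuous_apply_apply _ _
  · simp only [onPair, of_apply, if_neg h]
    exact continuous_const

theorem tensorOp_apply_zero [NeZero q] (M : Fin (q ^ 2) → Matrix (Fin q) (Fin q) ℂ)
    (x : Fin n → Fin (q ^ 2)) : tensorOp M x 0 0 = ∏ i, M (x i) 0 0 := rfl

theorem star_zeroKet_dotProduct_mulVec [NeZero q] (A : Op q n) :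
    star (zeroKet q n) ⬝ᵥ (A *ᵥ zeroKet q n) = A 0 0 := by
  rw [zeroKet, Pi.star_single, star_one, single_one_dotProduct, mulVec_single_one]
  rfl

end Sites

section Resample

variable {Γ : Type*} [Fintype Γ] [DecidableEq Γ] {X : Γ → Type*} [∀ g, MeasurableSpace (X g)]
  (μ : ∀ g, Measure (X g)) [∀ g, IsProbabilityMeasure (μ g)] (g : Γ)

theorem measurePreserving_update :
    MeasurePreserving (fun p : (∀ g, X g) × X g => Function.update p.1 g p.2)
      ((Measure.pi μ).prod (μ g)) (Measure.pi μ) := by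
  refine ⟨measurable_update', (Measure.pi_eq fun s hs => ?_).symm⟩
  have hpreimage : (fun p : (∀ g, X g) × X g => Function.update p.1 g p.2) ⁻¹' (Set.univ.pi s) =
      (Set.univ.pi (Function.update s g Set.univ)) ×ˢ (s g) := by
    ext ⟨V, v⟩
    simp only [Set.mem_preimage, Set.mem_pi, Set.mem_univ, true_implies, Set.mem_prod]
    rw [Function.forall_update_iff V (p := fun i y => y ∈ s i),
      Function.forall_update_iff s (p := fun i t => V i ∈ t), and_comm]
    simp only [Set.mem_univ, true_and]
  rw [Measure.map_apply measurable_update' (MeasurableSet.univ_pi hs), hpreimage,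
    Measure.prod_prod, Measure.pi_pi, mul_comm, ← Finset.mul_prod_erase _ _ (Finset.mem_univ g),
    ← Finset.mul_prod_erase Finset.univ (fun i => μ i (s i)) (Finset.mem_univ g),
    Function.update_self, measure_univ, one_mul]
  congr 1
  exact Finset.prod_congr rfl fun i hi => by rw [Function.update_of_ne (Finset.ne_of_mem_erase hi)]

theorem integral_pi_update {E : Type*} [NormedAddCommGroup E] [NormedSpace ℝ E]
    {f : (∀ g, X g) → E} (hf : Integrable f (Measure.pi μ)) :
    ∫ V, f V ∂(Measure.pi μ) = ∫ V, ∫ v, f (Function.update V g v) ∂(μ g) ∂(Measure.pi μ) := by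
  have hmp := measurePreserving_update μ g
  conv_lhs => rw [← hmp.map_eq]
  rw [integral_map hmp.measurable.aemeasurable (hmp.map_eq.symm ▸ hf.aestronglyMeasurable)]
  exact integral_prod _ (hmp.integrable_comp_of_integrable hf)

end Resample

section Counting

theorem card_sub_one_mul_le_sum_erase_zero {α β : Type*} [Fintype α] [Fintype β] [DecidableEq β]
    [Zero α] [Zero β] {f : α ↪ β} (hf : f 0 = 0) {F : β → ℝ} (hF : ∀ b, 0 ≤ F b)
    {c : ℝ} (hc : ∀ a, c ≤ F (f a)) :
    ((Fintype.card α : ℝ) - 1) * c ≤ ∑ b ∈ Finset.univ.erase 0, F b := by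
  classical
  calc ((Fintype.card α : ℝ) - 1) * c = ∑ _a ∈ Finset.univ.erase (0 : α), c := by
        rw [Finset.sum_const, nsmul_eq_mul, Finset.cast_card_erase_of_mem (Finset.mem_univ _),
          Finset.card_univ]
    _ ≤ ∑ a ∈ Finset.univ.erase (0 : α), F (f a) := Finset.sum_le_sum fun a _ => hc a
    _ = ∑ b ∈ (Finset.univ.erase (0 : α)).map f, F b := (Finset.sum_map ..).symm
    _ ≤ _ := by
        refine Finset.sum_le_sum_of_subset_of_nonneg ?_ fun b _ _ => hF b
        rw [Finset.map_erase, hf]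
        exact Finset.erase_subset_erase _ (Finset.subset_univ _)

variable {q : ℕ}

theorem pow_four_sub_one_pos (hq : 2 ≤ q) : (0 : ℝ) < (q : ℝ) ^ 4 - 1 :=
  sub_pos.mpr (one_lt_pow₀ (by exact_mod_cast hq) four_ne_zero)

theorem sq_sub_one_div_pow_four_sub_one (hq : 2 ≤ q) :
    ((q : ℝ) ^ 2 - 1) / ((q : ℝ) ^ 4 - 1) = 1 / ((q : ℝ) ^ 2 + 1) := by
  rw [div_eq_div_iff (pow_four_sub_one_pos hq).ne' (by positivity)]
  ring

variable [NeZero q]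

theorem card_erase_zero :
    ((Finset.univ.erase (0 : Fin (q ^ 2) × Fin (q ^ 2))).card : ℝ) = (q : ℝ) ^ 4 - 1 := by
  rw [Finset.cast_card_erase_of_mem (Finset.mem_univ _), Finset.card_univ, Fintype.card_prod,
    Fintype.card_fin]
  push_cast
  ring

theorem IsOperatorBasis.sum_erase_zero_norm_sq {M : Fin (q ^ 2) → Matrix (Fin q) (Fin q) ℂ}
    (hM : IsOperatorBasis M) :
    ∑ r ∈ Finset.univ.erase (0 : Fin (q ^ 2) × Fin (q ^ 2)), ‖M r.1 0 0‖ ^ 2 * ‖M r.2 0 0‖ ^ 2 =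
      (q : ℝ) ^ 2 - 1 := by
  have hprod : ∑ r : Fin (q ^ 2) × Fin (q ^ 2), ‖M r.1 0 0‖ ^ 2 * ‖M r.2 0 0‖ ^ 2 = q * q := by
    rw [Fintype.sum_prod_type, ← hM.sum_norm_sq_apply_zero, Finset.sum_mul_sum]
  rw [Finset.sum_erase_eq_sub (Finset.mem_univ _), hprod]
  simp [hM.zero_eq_one, sq]

end Counting

section Support

variable {q n : ℕ} [NeZero q]

/-- The multi-index `x` vanishes outside of `A`, i.e. `M_x` acts trivially outside of `A`. -/
def SupportedOn (A : Set (Fin n)) (x : Fin n → Fin (q ^ 2)) : Prop :=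
  ∀ i, x i ≠ 0 → i ∈ A

theorem SupportedOn.diff_singleton {A : Set (Fin n)} {x : Fin n → Fin (q ^ 2)}
    (hx : SupportedOn A x) {p : Fin n} (hp : x p = 0) : SupportedOn (A \ {p}) x :=
  fun i hi => ⟨hx i hi, fun h => hi (Set.mem_singleton_iff.mp h ▸ hp)⟩

end Support

/-- A circuit of two-site blocks `post * V * pre`, indexed by `Γ`, with `post` and `pre` fixed
unitaries and `V` to be drawn at random. The block `g` acts on the sites `fst g` and `snd g`. -/
structure BlockFamily (q n : ℕ) (Γ : Type*) where
  fst : Γ → Fin n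
  snd : Γ → Fin n
  fst_ne_snd : ∀ g, fst g ≠ snd g
  post : Γ → unitaryGroup (Fin q × Fin q) ℂ
  pre : Γ → unitaryGroup (Fin q × Fin q) ℂ

namespace BlockFamily

variable {q n : ℕ} {Γ : Type*} (B : BlockFamily q n Γ)

section Circuits

/-- The operator of the block `g` on its two sites, for the realization `v` of its random gate. -/
def block (g : Γ) (v : unitaryGroup (Fin q × Fin q) ℂ) : unitaryGroup (Fin q × Fin q) ℂ :=
  B.post g * v * B.pre g

/-- The product of the blocks in the list `gs`; the last block of the list is applied first. -/
def circ (gs : List Γ) (V : Γ → unitaryGroup (Fin q × Fin q) ℂ) : Op q n :=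
  (gs.map fun g => onPair (B.fst g) (B.snd g) (B.block g (V g))).prod

theorem continuous_circ (gs : List Γ) : Continuous (B.circ gs) := by
  refine continuous_list_prod _ fun g _ => (continuous_onPair _ _).comp ?_
  unfold block
  fun_prop

theorem circ_append (l gs : List Γ) (V : Γ → unitaryGroup (Fin q × Fin q) ℂ) :
    B.circ (l ++ gs) V = B.circ l V * B.circ gs V := by
  rw [circ, List.map_append, List.prod_append, circ, circ]

theorem circ_mem_unitaryGroup (gs : List Γ) (V : Γ → unitaryGroup (Fin q × Fin q) ℂ) :
    B.circ gs V ∈ unitaryGroup (Fin n → Fin q) ℂ := by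
  refine list_prod_mem fun G hG => ?_
  obtain ⟨g, -, rfl⟩ := List.mem_map.mp hG
  exact onPair_mem_unitaryGroup (B.fst_ne_snd g) (B.block g (V g)).2

variable [DecidableEq Γ]

theorem circ_update {gs : List Γ} {g : Γ} (hg : g ∉ gs)
    (V : Γ → unitaryGroup (Fin q × Fin q) ℂ) (v : unitaryGroup (Fin q × Fin q) ℂ) :
    B.circ gs (Function.update V g v) = B.circ gs V := by
  unfold circ
  congr 1
  exact List.map_congr_left fun g' hg' => by
    rw [Function.update_of_ne (ne_of_mem_of_not_mem hg' hg)]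

theorem circ_cons_update {gs : List Γ} {g : Γ} (hg : g ∉ gs)
    (V : Γ → unitaryGroup (Fin q × Fin q) ℂ) (v : unitaryGroup (Fin q × Fin q) ℂ) :
    B.circ (g :: gs) (Function.update V g v) =
      onPair (B.fst g) (B.snd g) (B.block g v) * B.circ gs V := by
  rw [← B.circ_update hg V v]
  simp only [circ, List.map_cons, List.prod_cons, Function.update_self]

theorem heisenberg_circ_cons_update {gs : List Γ} {g : Γ} (hg : g ∉ gs)
    (V : Γ → unitaryGroup (Fin q × Fin q) ℂ) (v : unitaryGroup (Fin q × Fin q) ℂ)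
    [NeZero q] (M : Fin (q ^ 2) → Matrix (Fin q) (Fin q) ℂ) (x : Fin n → Fin (q ^ 2)) :
    heisenberg (B.circ (g :: gs) (Function.update V g v)) (tensorOp M x) =
      heisenberg (B.circ gs V) (tensorOpWith (B.fst_ne_snd g) M x
        (heisenberg (B.block g v : PairOp q) (M (x (B.fst g)) ⊗ₖ M (x (B.snd g))))) := by
  rw [circ_cons_update B hg, heisenberg_mul, tensorOp_eq_tensorOpWith (B.fst_ne_snd g),
    heisenberg_onPair_tensorOpWith]

end Circuits

section Moments

variable [NeZero q] [Fintype Γ]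

/-- The second moment of the expectation value of `M_x`, in the state prepared from `|0^n⟩` by the
blocks in the list `gs`. The expectation value in `|0^n⟩` is the entry at `(0, 0)`. -/
def moment (μ : Γ → Measure (unitaryGroup (Fin q × Fin q) ℂ))
    (M : Fin (q ^ 2) → Matrix (Fin q) (Fin q) ℂ) (gs : List Γ) (x : Fin n → Fin (q ^ 2)) : ℝ :=
  ∫ V, ‖heisenberg (B.circ gs V) (tensorOp M x) 0 0‖ ^ 2 ∂(Measure.pi μ)

variable {μ : Γ → Measure (unitaryGroup (Fin q × Fin q) ℂ)}
  {M : Fin (q ^ 2) → Matrix (Fin q) (Fin q) ℂ}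

theorem moment_nonneg (gs : List Γ) (x : Fin n → Fin (q ^ 2)) : 0 ≤ B.moment μ M gs x :=
  integral_nonneg fun _ => by positivity

theorem moment_nil [∀ g, IsProbabilityMeasure (μ g)] (x : Fin n → Fin (q ^ 2)) :
    B.moment μ M [] x = ∏ i, ‖M (x i) 0 0‖ ^ 2 := by
  simp [moment, circ, heisenberg_apply, tensorOp_apply_zero, Finset.prod_pow]

theorem integrable_norm_sq_heisenberg_circ [∀ g, IsProbabilityMeasure (μ g)] (gs : List Γ)
    (A : Op q n) :
    Integrable (fun V => ‖heisenberg (B.circ gs V) A 0 0‖ ^ 2) (Measure.pi μ) :=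
  integrable_of_continuous_compact _ <| Continuous.pow
    ((((continuous_heisenberg A).comp (B.continuous_circ gs)).matrix_elem 0 0).norm) 2

theorem moment_cons [∀ g, IsProbabilityMeasure (μ g)] {gs : List Γ} {g : Γ} (hg : g ∉ gs)
    (x : Fin n → Fin (q ^ 2)) :
    B.moment μ M (g :: gs) x = ∫ V, ∫ v, ‖heisenberg (B.circ gs V)
      (tensorOpWith (B.fst_ne_snd g) M x (heisenberg (B.block g v : PairOp q)
        (M (x (B.fst g)) ⊗ₖ M (x (B.snd g))))) 0 0‖ ^ 2 ∂(μ g) ∂(Measure.pi μ) := by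
  classical
  rw [moment, integral_pi_update μ g (B.integrable_norm_sq_heisenberg_circ _ _)]
  simp only [B.heisenberg_circ_cons_update hg]

theorem moment_cons_of_trivial [∀ g, IsProbabilityMeasure (μ g)] (hM : IsOperatorBasis M)
    {gs : List Γ} {g : Γ} (hg : g ∉ gs) {x : Fin n → Fin (q ^ 2)}
    (hx : x (B.fst g) = 0 ∧ x (B.snd g) = 0) :
    B.moment μ M (g :: gs) x = B.moment μ M gs x := by
  have hone : M (x (B.fst g)) ⊗ₖ M (x (B.snd g)) = 1 := by
    rw [hx.1, hx.2, hM.zero_eq_one, one_kronecker_one]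
  rw [B.moment_cons hg]
  simp only [hone, heisenberg_one, integral_const, probReal_univ, one_smul]
  rw [← hone]
  simp only [← tensorOp_eq_tensorOpWith]
  rfl

theorem moment_cons_of_nontrivial (hM : IsOperatorBasis M) (hq : 2 ≤ q)
    (hμ : ∀ g, IsTwoDesign (μ g)) {gs : List Γ} {g : Γ} (hg : g ∉ gs) {x : Fin n → Fin (q ^ 2)}
    (hx : ¬ (x (B.fst g) = 0 ∧ x (B.snd g) = 0)) :
    B.moment μ M (g :: gs) x =
      (∑ r ∈ Finset.univ.erase (0 : Fin (q ^ 2) × Fin (q ^ 2)),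
        B.moment μ M gs (setPair x (B.fst g) (B.snd g) r)) / ((q : ℝ) ^ 4 - 1) := by
  have := fun g => (hμ g).isProbabilityMeasure
  have hr : (x (B.fst g), x (B.snd g)) ≠ 0 := fun h => hx (Prod.ext_iff.mp h)
  have hmix (V : Γ → unitaryGroup (Fin q × Fin q) ℂ) :=
    hM.integral_norm_sq_kronecker hq (hμ g) hr (entryLinearMap ℂ ℂ 0 0 ∘ₗ
      heisenberg (B.circ gs V) ∘ₗ tensorOpWith (B.fst_ne_snd g) M x) (B.post g) (B.pre g)
  simp only [LinearMap.comp_apply, entryLinearMap_apply, tensorOpWith_kronecker] at hmix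
  rw [B.moment_cons hg]
  simp only [block, Submonoid.coe_mul, hmix, integral_div]
  rw [integral_finsetSum _ fun r _ => B.integrable_norm_sq_heisenberg_circ gs _]
  rfl

end Moments

section DisjointBlocks

/-- The two sites on which the block `g` acts. -/
def sites (g : Γ) : Finset (Fin n) := {B.fst g, B.snd g}

theorem mem_sites {g : Γ} {i : Fin n} : i ∈ B.sites g ↔ i = B.fst g ∨ i = B.snd g := by
  rw [sites, Finset.mem_insert, Finset.mem_singleton]

theorem setPair_of_notMem_sites {β : Type*} {x : Fin n → β} {r : β × β} {g : Γ} {i : Fin n}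
    (hi : i ∉ B.sites g) : setPair x (B.fst g) (B.snd g) r i = x i := by
  rw [mem_sites, not_or] at hi
  exact setPair_of_ne x r hi.1 hi.2

/-- The sites on which none of the blocks in the list `gs` acts. -/
def freeSites (gs : List Γ) : Finset (Fin n) := {i | ∀ g ∈ gs, i ∉ B.sites g}

theorem mem_freeSites {gs : List Γ} {i : Fin n} :
    i ∈ B.freeSites gs ↔ ∀ g ∈ gs, i ∉ B.sites g := by
  rw [freeSites, Finset.mem_filter_univ]

theorem prod_freeSites {R : Type*} [CommMonoid R] {g : Γ} {gs : List Γ}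
    (hg : ∀ g' ∈ gs, Disjoint (B.sites g) (B.sites g')) (f : Fin n → R) :
    ∏ i ∈ B.freeSites gs, f i =
      (∏ i ∈ B.freeSites (g :: gs), f i) * (f (B.fst g) * f (B.snd g)) := by
  have hsub : B.sites g ⊆ B.freeSites gs := fun i hi =>
    B.mem_freeSites.mpr fun g' hg' => Finset.disjoint_left.mp (hg g' hg') hi
  have hsdiff : B.freeSites (g :: gs) = B.freeSites gs \ B.sites g := by
    ext i
    simp only [mem_freeSites, List.forall_mem_cons, Finset.mem_sdiff, and_comm]
  rw [hsdiff, ← Finset.prod_pair (B.fst_ne_snd g), ← sites, Finset.prod_sdiff hsub]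

variable [NeZero q]

/-- The second moment contributed by the block `g` acting directly on a computational basis
state. -/
def weight (x : Fin n → Fin (q ^ 2)) (g : Γ) : ℝ :=
  if x (B.fst g) = 0 ∧ x (B.snd g) = 0 then 1 else 1 / ((q : ℝ) ^ 2 + 1)

theorem weight_setPair {g g' : Γ} (h : Disjoint (B.sites g) (B.sites g'))
    (x : Fin n → Fin (q ^ 2)) (r : Fin (q ^ 2) × Fin (q ^ 2)) :
    B.weight (setPair x (B.fst g) (B.snd g) r) g' = B.weight x g' := by
  rw [Finset.disjoint_right] at h
  rw [weight, weight, B.setPair_of_notMem_sites (h (B.mem_sites.mpr (.inl rfl))),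
    B.setPair_of_notMem_sites (h (B.mem_sites.mpr (.inr rfl)))]

variable [Fintype Γ] {μ : Γ → Measure (unitaryGroup (Fin q × Fin q) ℂ)}
  {M : Fin (q ^ 2) → Matrix (Fin q) (Fin q) ℂ}

theorem moment_of_pairwise_disjoint (hM : IsOperatorBasis M) (hq : 2 ≤ q)
    (hμ : ∀ g, IsTwoDesign (μ g)) {gs : List Γ} (hnd : gs.Nodup)
    (hdisj : gs.Pairwise fun g g' => Disjoint (B.sites g) (B.sites g'))
    (x : Fin n → Fin (q ^ 2)) :
    B.moment μ M gs x = (gs.map (B.weight x)).prod * ∏ i ∈ B.freeSites gs, ‖M (x i) 0 0‖ ^ 2 := by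
  have := fun g => (hμ g).isProbabilityMeasure
  induction gs generalizing x with
  | nil => simp [B.moment_nil, freeSites]
  | cons g gs ih =>
    rw [List.nodup_cons] at hnd
    rw [List.pairwise_cons] at hdisj
    have hsplit (f : Fin n → ℝ) := B.prod_freeSites hdisj.1 f
    by_cases hx : x (B.fst g) = 0 ∧ x (B.snd g) = 0
    · rw [B.moment_cons_of_trivial hM hnd.1 hx, ih hnd.2 hdisj.2, hsplit, hx.1, hx.2,
        hM.zero_eq_one]
      simp [weight, hx]
    · have hterm (r : Fin (q ^ 2) × Fin (q ^ 2)) :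
          B.moment μ M gs (setPair x (B.fst g) (B.snd g) r) =
            (gs.map (B.weight x)).prod * (∏ i ∈ B.freeSites (g :: gs), ‖M (x i) 0 0‖ ^ 2) *
              (‖M r.1 0 0‖ ^ 2 * ‖M r.2 0 0‖ ^ 2) := by
        have hfree : ∏ i ∈ B.freeSites (g :: gs),
            ‖M (setPair x (B.fst g) (B.snd g) r i) 0 0‖ ^ 2 =
              ∏ i ∈ B.freeSites (g :: gs), ‖M (x i) 0 0‖ ^ 2 :=
          Finset.prod_congr rfl fun i hi => by
            rw [setPair_of_notMem_sites B (B.mem_freeSites.mp hi g List.mem_cons_self)]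
        rw [ih hnd.2 hdisj.2, hsplit, setPair_fst x r (B.fst_ne_snd g), setPair_snd, hfree,
          List.map_congr_left fun g' hg' => B.weight_setPair (hdisj.1 g' hg') x r, mul_assoc]
      rw [B.moment_cons_of_nontrivial hM hq hμ hnd.1 hx, Finset.sum_congr rfl fun r _ => hterm r,
        ← Finset.mul_sum, hM.sum_erase_zero_norm_sq, mul_div_assoc,
        sq_sub_one_div_pow_four_sub_one hq, List.map_cons, List.prod_cons, weight, if_neg hx]
      ring

theorem moment_of_covering (hM : IsOperatorBasis M) (hq : 2 ≤ q)
    (hμ : ∀ g, IsTwoDesign (μ g)) {gs : List Γ} (hnd : gs.Nodup)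
    (hdisj : gs.Pairwise fun g g' => Disjoint (B.sites g) (B.sites g'))
    (hcov : ∀ i, ∃ g ∈ gs, i ∈ B.sites g) (x : Fin n → Fin (q ^ 2)) :
    B.moment μ M gs x = (gs.map (B.weight x)).prod := by
  have hfree : B.freeSites gs = ∅ := Finset.eq_empty_of_forall_notMem fun i hi => by
    obtain ⟨g, hg, hig⟩ := hcov i
    exact B.mem_freeSites.mp hi g hg hig
  rw [B.moment_of_pairwise_disjoint hM hq hμ hnd hdisj, hfree, Finset.prod_empty, mul_one]

end DisjointBlocks

section Support

variable [NeZero q] [Fintype Γ] {μ : Γ → Measure (unitaryGroup (Fin q × Fin q) ℂ)}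
  {M : Fin (q ^ 2) → Matrix (Fin q) (Fin q) ℂ} {A : Set (Fin n)}

omit [Fintype Γ] in
theorem supportedOn_setPair {g : Γ} (hA : B.fst g ∈ A ↔ B.snd g ∈ A) {x : Fin n → Fin (q ^ 2)}
    (hx : SupportedOn A x) (hxg : ¬ (x (B.fst g) = 0 ∧ x (B.snd g) = 0))
    (r : Fin (q ^ 2) × Fin (q ^ 2)) : SupportedOn A (setPair x (B.fst g) (B.snd g) r) := by
  have hfst : B.fst g ∈ A := by
    by_contra hfst
    exact hxg ⟨by_contra fun h => hfst (hx _ h), by_contra fun h => hfst (hA.mpr (hx _ h))⟩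
  intro i hi
  by_cases hmem : i ∈ B.sites g
  · rcases B.mem_sites.mp hmem with rfl | rfl
    exacts [hfst, hA.mp hfst]
  · rw [B.setPair_of_notMem_sites hmem] at hi
    exact hx i hi

theorem le_moment_cons (hM : IsOperatorBasis M) (hq : 2 ≤ q) (hμ : ∀ g, IsTwoDesign (μ g))
    {g : Γ} {gs : List Γ} (hg : g ∉ gs) (hA : B.fst g ∈ A ↔ B.snd g ∈ A) {c : ℝ}
    (hc : ∀ x, SupportedOn A x → c ≤ B.moment μ M gs x) {x : Fin n → Fin (q ^ 2)}
    (hx : SupportedOn A x) : c ≤ B.moment μ M (g :: gs) x := by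
  have := fun g => (hμ g).isProbabilityMeasure
  by_cases hxg : x (B.fst g) = 0 ∧ x (B.snd g) = 0
  · rw [B.moment_cons_of_trivial hM hg hxg]
    exact hc x hx
  · rw [B.moment_cons_of_nontrivial hM hq hμ hg hxg, le_div_iff₀ (pow_four_sub_one_pos hq),
      ← card_erase_zero, mul_comm, ← nsmul_eq_mul]
    exact Finset.card_nsmul_le_sum _ _ _ fun r _ => hc _ (B.supportedOn_setPair hA hx hxg r)

theorem le_moment_append (hM : IsOperatorBasis M) (hq : 2 ≤ q) (hμ : ∀ g, IsTwoDesign (μ g))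
    {l gs : List Γ} (hnd : (l ++ gs).Nodup) (hA : ∀ g ∈ l, B.fst g ∈ A ↔ B.snd g ∈ A) {c : ℝ}
    (hc : ∀ x, SupportedOn A x → c ≤ B.moment μ M gs x) {x : Fin n → Fin (q ^ 2)}
    (hx : SupportedOn A x) : c ≤ B.moment μ M (l ++ gs) x := by
  induction l generalizing x with
  | nil => exact hc x hx
  | cons g l ih =>
    rw [List.cons_append, List.nodup_cons] at hnd
    exact B.le_moment_cons hM hq hμ hnd.1 (hA g List.mem_cons_self)
      (fun y hy => ih hnd.2 (fun g' hg' => hA g' (List.mem_cons_of_mem _ hg')) hy) hx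

omit [Fintype Γ] in
theorem exists_embedding_setPair_eq_zero {g : Γ} {p : Fin n} (hp : p ∈ B.sites g)
    (x : Fin n → Fin (q ^ 2)) :
    ∃ f : Fin (q ^ 2) ↪ Fin (q ^ 2) × Fin (q ^ 2),
      f 0 = 0 ∧ ∀ b, setPair x (B.fst g) (B.snd g) (f b) p = 0 := by
  rcases B.mem_sites.mp hp with rfl | rfl
  · exact ⟨.sectR 0 _, rfl, fun b => setPair_fst x _ (B.fst_ne_snd g)⟩
  · exact ⟨.sectL _ 0, rfl, fun b => setPair_snd x _⟩

/-- Among the `q ^ 4 - 1` nontrivial values at the sites of `g`, the `q ^ 2 - 1` ones that are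
trivial at `p` give a fraction `1 / (q ^ 2 + 1)`. -/
theorem le_moment_cons_diff (hM : IsOperatorBasis M) (hq : 2 ≤ q) (hμ : ∀ g, IsTwoDesign (μ g))
    {g : Γ} {gs : List Γ} (hg : g ∉ gs) (hA : B.fst g ∈ A ↔ B.snd g ∈ A) {p : Fin n}
    (hp : p ∈ B.sites g) {c : ℝ} (hc₀ : 0 ≤ c)
    (hc : ∀ x, SupportedOn (A \ {p}) x → c ≤ B.moment μ M gs x) {x : Fin n → Fin (q ^ 2)}
    (hx : SupportedOn A x) : c / ((q : ℝ) ^ 2 + 1) ≤ B.moment μ M (g :: gs) x := by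
  have := fun g => (hμ g).isProbabilityMeasure
  by_cases hxg : x (B.fst g) = 0 ∧ x (B.snd g) = 0
  · have hxp : x p = 0 := by
      rcases B.mem_sites.mp hp with rfl | rfl
      exacts [hxg.1, hxg.2]
    rw [B.moment_cons_of_trivial hM hg hxg]
    exact (div_le_self hc₀ (le_add_of_nonneg_left (sq_nonneg _))).trans
      (hc x (hx.diff_singleton hxp))
  · obtain ⟨f, hf₀, hfp⟩ := B.exists_embedding_setPair_eq_zero hp x
    rw [B.moment_cons_of_nontrivial hM hq hμ hg hxg]
    calc c / ((q : ℝ) ^ 2 + 1) = ((q : ℝ) ^ 2 - 1) * c / ((q : ℝ) ^ 4 - 1) := by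
          rw [mul_div_right_comm, sq_sub_one_div_pow_four_sub_one hq, one_div_mul_eq_div]
      _ ≤ _ := by
          gcongr
          · exact (pow_four_sub_one_pos hq).le
          · have := card_sub_one_mul_le_sum_erase_zero hf₀ (fun r => B.moment_nonneg gs
              (setPair x (B.fst g) (B.snd g) r)) fun b => hc _
                ((B.supportedOn_setPair hA hx hxg (f b)).diff_singleton (hfp b))
            simpa using this

/-- Only the block at `p` shrinks the support; the other blocks of the layer preserve it. -/
theorem le_moment_append_diff (hM : IsOperatorBasis M) (hq : 2 ≤ q) (hμ : ∀ g, IsTwoDesign (μ g))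
    {l gs : List Γ} (hnd : (l ++ gs).Nodup) (hA : ∀ g ∈ l, B.fst g ∈ A ↔ B.snd g ∈ A) {p : Fin n}
    (hp : ∃! g, g ∈ l ∧ p ∈ B.sites g) {c : ℝ} (hc₀ : 0 ≤ c)
    (hc : ∀ x, SupportedOn (A \ {p}) x → c ≤ B.moment μ M gs x) {x : Fin n → Fin (q ^ 2)}
    (hx : SupportedOn A x) : c / ((q : ℝ) ^ 2 + 1) ≤ B.moment μ M (l ++ gs) x := by
  obtain ⟨g₀, ⟨hg₀, hpg₀⟩, hunique⟩ := hp
  obtain ⟨l₁, l₂, rfl⟩ := List.append_of_mem hg₀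
  rw [List.append_assoc] at hnd ⊢
  refine B.le_moment_append hM hq hμ hnd (fun g hg => hA g (by simp [hg])) (fun y hy => ?_) hx
  have hnd₂ := (List.nodup_append.mp hnd).2.1
  rw [List.cons_append, List.nodup_cons] at hnd₂
  refine B.le_moment_cons_diff hM hq hμ hnd₂.1 (hA g₀ hg₀) hpg₀ hc₀ (fun z hz => ?_) hy
  refine B.le_moment_append hM hq hμ hnd₂.2 (fun g hg => ?_) hc hz
  have hmem : g ∈ l₁ ++ g₀ :: l₂ := by simp [hg]
  have hpg : p ∉ B.sites g := fun h =>
    hnd₂.1 (List.mem_append_left _ (hunique g ⟨hmem, h⟩ ▸ hg))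
  rw [mem_sites, not_or] at hpg
  simp [hA g hmem, Ne.symm hpg.1, Ne.symm hpg.2]

end Support

end BlockFamily

section Sites

variable {n : ℕ}

theorem sndSite_of_odd {τ : ℕ} (h : Odd τ) (j : Fin (n / 2)) : (sndSite τ j : ℕ) = 2 * j + 1 := by
  rw [sndSite, if_pos h]

theorem sndSite_of_not_odd {τ : ℕ} (h : ¬ Odd τ) (j : Fin (n / 2)) :
    (sndSite τ j : ℕ) = if (j : ℕ) = 0 then n - 1 else 2 * j - 1 := by
  have hsnd : (sndSite τ j : ℕ) = (2 * j + n - 1) % n := by rw [sndSite, if_neg h]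
  split_ifs with h₀
  · rw [hsnd, h₀, Nat.mod_eq_of_lt (by omega), Nat.mul_zero, Nat.zero_add]
  · rw [hsnd, show 2 * (j : ℕ) + n - 1 = (2 * j - 1) + n by omega, Nat.add_mod_right]
    exact Nat.mod_eq_of_lt (by omega)

theorem fstSite_ne_sndSite (hn : Even n) (τ : ℕ) (j j' : Fin (n / 2)) :
    fstSite j ≠ sndSite τ j' := by
  obtain ⟨m, hm⟩ := hn
  intro h
  rw [Fin.ext_iff, fstSite, Fin.val_mk] at h
  by_cases hτ : Odd τ
  · rw [sndSite_of_odd hτ] at h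
    omega
  · rw [sndSite_of_not_odd hτ] at h
    split_ifs at h <;> omega

theorem fstSite_injective : Function.Injective (fstSite : Fin (n / 2) → Fin n) := by
  intro j j' h
  rw [fstSite, fstSite, Fin.mk.injEq] at h
  omega

theorem sndSite_injective (τ : ℕ) : Function.Injective (sndSite τ : Fin (n / 2) → Fin n) := by
  intro j j' h
  rw [Fin.ext_iff] at h
  by_cases hτ : Odd τ
  · rw [sndSite_of_odd hτ, sndSite_of_odd hτ] at h
    omega
  · rw [sndSite_of_not_odd hτ, sndSite_of_not_odd hτ] at h
    split_ifs at h <;> omega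

theorem exists_eq_fstSite_or_eq_sndSite (hn : Even n) (τ : ℕ) (i : Fin n) :
    ∃ j, i = fstSite j ∨ i = sndSite τ j := by
  obtain ⟨m, hm⟩ := hn
  simp only [Fin.ext_iff]
  rcases Nat.even_or_odd' (i : ℕ) with ⟨c, hc | hc⟩
  · exact ⟨⟨c, by omega⟩, .inl hc⟩
  by_cases hτ : Odd τ
  · exact ⟨⟨c, by omega⟩, .inr ((sndSite_of_odd hτ _).trans hc.symm).symm⟩
  · simp only [sndSite_of_not_odd hτ]
    by_cases hlast : (i : ℕ) = n - 1
    · exact ⟨⟨0, by omega⟩, .inr hlast⟩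
    · refine ⟨⟨c + 1, by omega⟩, .inr ?_⟩
      rw [if_neg c.succ_ne_zero]
      change (i : ℕ) = 2 * (c + 1) - 1
      omega

end Sites

section Arcs

variable {n : ℕ}

/-- The arc formed by the `m` sites `a, a + 1, …, a + m - 1` (modulo `n`) of the ring. -/
def arc (n a m : ℕ) : Set (Fin n) := {i | ∃ r < m, (i : ℕ) ≡ a + r [MOD n]}

theorem arc_diff_singleton_subset {a : ℕ} {p : Fin n} (hp : (p : ℕ) ≡ a [MOD n]) (m : ℕ) :
    arc n a m \ {p} ⊆ arc n (a + 1) m := by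
  rintro i ⟨⟨r, hr, hir⟩, hip⟩
  have hr₀ : r ≠ 0 := by
    rintro rfl
    exact hip (Fin.ext ((hir.trans hp.symm).eq_of_lt_of_lt i.isLt p.isLt))
  exact ⟨r - 1, by omega, by rwa [show a + 1 + (r - 1) = a + r by omega]⟩

theorem mem_arc_iff_of_consecutive (hn : Even n) {a b p : ℕ} (hp : p ≡ a [MOD 2]) {i j : Fin n}
    (hi : (i : ℕ) ≡ p [MOD n]) (hj : (j : ℕ) ≡ p + 1 [MOD n]) :
    i ∈ arc n a (2 * b) ↔ j ∈ arc n a (2 * b) := by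
  constructor
  · rintro ⟨r, hr, hir⟩
    have hpr : p ≡ a + r [MOD n] := hi.symm.trans hir
    have hpar : p ≡ a + r [MOD 2] := hpr.of_dvd hn.two_dvd
    refine ⟨r + 1, ?_, hj.trans (hpr.add_right 1)⟩
    unfold Nat.ModEq at hpar hp
    omega
  · rintro ⟨r, hr, hjr⟩
    have hpr : p + 1 ≡ a + r [MOD n] := hj.symm.trans hjr
    have hpar : p + 1 ≡ a + r [MOD 2] := hpr.of_dvd hn.two_dvd
    unfold Nat.ModEq at hpar hp
    refine ⟨r - 1, by omega, hi.trans (Nat.ModEq.add_right_cancel' 1 ?_)⟩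
    rwa [show a + (r - 1) + 1 = a + r by omega]

theorem fstSite_mem_arc_iff (hn : Even n) {a b t : ℕ} (ha : a ≡ t [MOD 2]) (j : Fin (n / 2)) :
    fstSite j ∈ arc n a (2 * b) ↔ sndSite (t + 1) j ∈ arc n a (2 * b) := by
  by_cases hτ : Odd (t + 1)
  · refine mem_arc_iff_of_consecutive hn (p := 2 * j) ?_ rfl ?_
    · unfold Nat.ModEq at *
      obtain ⟨m, hm⟩ := hτ
      omega
    · rw [sndSite_of_odd hτ]
  · refine (mem_arc_iff_of_consecutive hn (p := 2 * j + n - 1) ?_ ?_ ?_).symm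
    · unfold Nat.ModEq at *
      obtain ⟨m, hm⟩ := Nat.not_odd_iff_even.mp hτ
      obtain ⟨m', hm'⟩ := hn
      omega
    · rw [sndSite, if_neg hτ]
      exact Nat.mod_modEq _ _
    · rw [show 2 * (j : ℕ) + n - 1 + 1 = 2 * j + n by omega]
      exact Nat.add_modEq_right.symm

variable {q : ℕ} [NeZero q]

theorem IsSpatiallyLocal.exists_supportedOn_arc (hn : Even n) {k : ℕ} {x : Fin n → Fin (q ^ 2)}
    (hx : IsSpatiallyLocal k x) (t : ℕ) :
    ∃ a, a ≡ t [MOD 2] ∧ SupportedOn (arc n a (2 * (k / 2 + 1))) x := by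
  obtain ⟨a, ha⟩ := hx
  by_cases hpar : a ≡ t [MOD 2]
  · refine ⟨a, hpar, fun i hi => ?_⟩
    obtain ⟨r, hr, hir⟩ := ha i hi
    exact ⟨r, by omega, hir ▸ Nat.mod_modEq _ _⟩
  · rcases n.eq_zero_or_pos with rfl | hn₀
    · exact ⟨t, rfl, fun i => i.elim0⟩
    refine ⟨a + n - 1, ?_, fun i hi => ?_⟩
    · obtain ⟨m, hm⟩ := hn
      unfold Nat.ModEq at hpar ⊢
      omega
    · obtain ⟨r, hr, hir⟩ := ha i hi
      refine ⟨r + 1, by omega, ?_⟩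
      rw [hir, show a + n - 1 + (r + 1) = a + r + n by omega]
      exact (Nat.mod_modEq _ _).trans Nat.add_modEq_right.symm

/-- The gates of the first timestep on which `M_x` acts nontrivially. -/
def activeGates (x : Fin n → Fin (q ^ 2)) : Finset (Fin (n / 2)) :=
  {j | ¬ (x (fstSite j) = 0 ∧ x (sndSite 1 j) = 0)}

theorem card_activeGates_le_half (x : Fin n → Fin (q ^ 2)) : (activeGates x).card ≤ n / 2 := by
  simpa using (activeGates x).card_le_univ

theorem SupportedOn.card_activeGates_le (hn : Even n) {a b : ℕ} (ha : a ≡ 0 [MOD 2])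
    {x : Fin n → Fin (q ^ 2)} (hx : SupportedOn (arc n a (2 * b)) x) :
    (activeGates x).card ≤ b := by
  have hpos : ∀ j ∈ activeGates x, ∃ r < b, 2 * (j : ℕ) ≡ a + 2 * r [MOD n] := by
    intro j hj
    have hmem : fstSite j ∈ arc n a (2 * b) := by
      by_contra hnot
      exact (Finset.mem_filter_univ j).mp hj ⟨by_contra fun h => hnot (hx _ h), by_contra fun h =>
        hnot ((fstSite_mem_arc_iff hn ha j).mpr (hx _ h))⟩
    obtain ⟨r, hr, hjr : 2 * (j : ℕ) ≡ a + r [MOD n]⟩ := hmem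
    have hpar : 2 * (j : ℕ) ≡ a + r [MOD 2] := hjr.of_dvd hn.two_dvd
    unfold Nat.ModEq at hpar ha
    exact ⟨r / 2, by omega, by rwa [show 2 * (r / 2) = r by omega]⟩
  choose! f hfb hf using hpos
  rw [← Finset.card_range b]
  refine Finset.card_le_card_of_injOn f (fun j hj => by simpa using hfb j hj) ?_
  intro j hj j' hj' h
  have hmod : 2 * (j : ℕ) ≡ 2 * j' [MOD n] := (hf j hj).trans (h ▸ (hf j' hj').symm)
  have := hmod.eq_of_lt_of_lt (by omega) (by omega)
  omega

end Arcs

section Layers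

variable {n d : ℕ}

/-- The gates of timestep `t + 1`. -/
def layerGates (n : ℕ) (t : Fin d) : List (GateIdx n d) := List.ofFn fun j => (t, j)

theorem mem_layerGates {t : Fin d} {g : GateIdx n d} : g ∈ layerGates n t ↔ g.1 = t := by
  rw [layerGates, List.mem_ofFn]
  exact ⟨fun ⟨_, h⟩ => h ▸ rfl, fun h => ⟨g.2, h ▸ rfl⟩⟩

theorem nodup_layerGates (t : Fin d) : (layerGates n t).Nodup :=
  List.nodup_ofFn.mpr fun _ _ h => (Prod.ext_iff.mp h).2

/-- The gates of the first `m` timesteps, the latest timestep first. -/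
def gatesUpTo (n : ℕ) : ∀ m, m ≤ d → List (GateIdx n d)
  | 0, _ => []
  | m + 1, h => layerGates n ⟨m, h⟩ ++ gatesUpTo n m (Nat.le_of_succ_le h)

theorem lt_of_mem_gatesUpTo {m : ℕ} (hm : m ≤ d) {g : GateIdx n d} (hg : g ∈ gatesUpTo n m hm) :
    (g.1 : ℕ) < m := by
  induction m with
  | zero => exact absurd hg List.not_mem_nil
  | succ m ih =>
    rcases List.mem_append.mp hg with hg | hg
    · rw [mem_layerGates.mp hg]
      exact m.lt_succ_self
    · exact (ih _ hg).trans m.lt_succ_self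

theorem nodup_gatesUpTo {m : ℕ} (hm : m ≤ d) : (gatesUpTo n m hm).Nodup := by
  induction m with
  | zero => exact List.nodup_nil
  | succ m ih =>
    refine (nodup_layerGates _).append (ih _) fun g hg hg' => ?_
    exact (lt_of_mem_gatesUpTo _ hg').ne (congrArg Fin.val (mem_layerGates.mp hg))

end Layers

/-- The blocks of a brickwork circuit, with fixed unitaries around the random gates. -/
def brickwork {q n d : ℕ} (hn : Even n)
    (post pre : GateIdx n d → unitaryGroup (Fin q × Fin q) ℂ) :
    BlockFamily q n (GateIdx n d) where
  fst g := fstSite g.2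
  snd g := sndSite (g.1 + 1) g.2
  fst_ne_snd _ := fstSite_ne_sndSite hn _ _ _
  post := post
  pre := pre

section Brickwork

variable {q n d : ℕ} {hn : Even n} {post pre : GateIdx n d → unitaryGroup (Fin q × Fin q) ℂ}

theorem disjoint_sites_brickwork {g g' : GateIdx n d} (ht : g.1 = g'.1) (hne : g ≠ g') :
    Disjoint ((brickwork hn post pre).sites g) ((brickwork hn post pre).sites g') := by
  have hj : g.2 ≠ g'.2 := fun h => hne (Prod.ext ht h)
  simp only [BlockFamily.sites, brickwork, ht, Finset.disjoint_insert_left,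
    Finset.disjoint_singleton_left, Finset.mem_insert, Finset.mem_singleton, not_or]
  exact ⟨⟨fstSite_injective.ne hj, fstSite_ne_sndSite hn _ _ _⟩,
    (fstSite_ne_sndSite hn _ _ _).symm, (sndSite_injective _).ne hj⟩

theorem existsUnique_mem_sites_brickwork (t : Fin d) (i : Fin n) :
    ∃! g, g ∈ layerGates n t ∧ i ∈ (brickwork hn post pre).sites g := by
  obtain ⟨j, hj⟩ := exists_eq_fstSite_or_eq_sndSite hn (t + 1) i
  have hi : i ∈ (brickwork hn post pre).sites (t, j) := BlockFamily.mem_sites _ |>.mpr hj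
  refine ⟨(t, j), ⟨mem_layerGates.mpr rfl, hi⟩, fun g ⟨hg, hig⟩ => ?_⟩
  by_contra hne
  exact Finset.disjoint_left.mp (disjoint_sites_brickwork (mem_layerGates.mp hg) hne) hig hi

variable [NeZero q] {μ : GateIdx n d → Measure (unitaryGroup (Fin q × Fin q) ℂ)}
  {M : Fin (q ^ 2) → Matrix (Fin q) (Fin q) ℂ}

theorem moment_first_layer (hM : IsOperatorBasis M) (hq : 2 ≤ q) (hμ : ∀ g, IsTwoDesign (μ g))
    (hd : 1 ≤ d) (x : Fin n → Fin (q ^ 2)) :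
    (brickwork hn post pre).moment μ M (gatesUpTo n 1 hd) x =
      1 / ((q : ℝ) ^ 2 + 1) ^ (activeGates x).card := by
  have hlayer : gatesUpTo n 1 hd = layerGates n ⟨0, hd⟩ := List.append_nil _
  rw [hlayer, BlockFamily.moment_of_covering _ hM hq hμ (nodup_layerGates _)]
  · rw [layerGates, List.map_ofFn, List.prod_ofFn, ← _root_.one_div_pow, activeGates]
    simp only [Function.comp_def, BlockFamily.weight]
    rw [Finset.prod_ite, Finset.prod_const_one, one_mul, Finset.prod_const]
    rfl
  · exact (nodup_layerGates _).imp_of_mem fun hg hg' hne =>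
      disjoint_sites_brickwork ((mem_layerGates.mp hg).trans (mem_layerGates.mp hg').symm) hne
  · exact fun i => (existsUnique_mem_sites_brickwork ⟨0, hd⟩ i).exists

theorem one_div_pow_le_moment (hM : IsOperatorBasis M) (hq : 2 ≤ q)
    (hμ : ∀ g, IsTwoDesign (μ g)) {t : ℕ} (ht : t < d) (x : Fin n → Fin (q ^ 2)) :
    1 / ((q : ℝ) + 1) ^ n ≤ (brickwork hn post pre).moment μ M (gatesUpTo n (t + 1) ht) x := by
  induction t generalizing x with
  | zero =>
    rw [moment_first_layer hM hq hμ ht]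
    refine one_div_le_one_div_of_le (by positivity) ?_
    calc ((q : ℝ) ^ 2 + 1) ^ (activeGates x).card ≤ ((q : ℝ) ^ 2 + 1) ^ (n / 2) :=
          pow_le_pow_right₀ (le_add_of_nonneg_left (sq_nonneg _)) (card_activeGates_le_half x)
      _ ≤ (((q : ℝ) + 1) ^ 2) ^ (n / 2) := by
          gcongr
          nlinarith [(Nat.cast_nonneg q : (0 : ℝ) ≤ q)]
      _ = ((q : ℝ) + 1) ^ n := by rw [← pow_mul, Nat.two_mul_div_two_of_even hn]
  | succ t ih =>
    exact BlockFamily.le_moment_append _ hM hq hμ (nodup_gatesUpTo ht) (A := Set.univ)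
      (fun _ _ => Iff.rfl) (fun y _ => ih _ y) fun i _ => Set.mem_univ i

theorem one_div_pow_le_moment_of_supportedOn_arc (hM : IsOperatorBasis M) (hq : 2 ≤ q)
    (hμ : ∀ g, IsTwoDesign (μ g)) {a b t : ℕ} (ht : t < d) (ha : a ≡ t [MOD 2])
    {x : Fin n → Fin (q ^ 2)} (hx : SupportedOn (arc n a (2 * b)) x) :
    1 / ((q : ℝ) ^ 2 + 1) ^ (b + t) ≤
      (brickwork hn post pre).moment μ M (gatesUpTo n (t + 1) ht) x := by
  have hone : (1 : ℝ) ≤ (q : ℝ) ^ 2 + 1 := le_add_of_nonneg_left (sq_nonneg _)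
  rcases n.eq_zero_or_pos with rfl | hn₀
  · calc 1 / ((q : ℝ) ^ 2 + 1) ^ (b + t) ≤ 1 / ((q : ℝ) + 1) ^ 0 := by
          rw [pow_zero]
          exact one_div_le_one_div_of_le one_pos (one_le_pow₀ hone)
      _ ≤ _ := one_div_pow_le_moment hM hq hμ ht x
  induction t generalizing x a with
  | zero =>
    rw [moment_first_layer hM hq hμ ht]
    exact one_div_le_one_div_of_le (by positivity) <|
      pow_le_pow_right₀ hone (hx.card_activeGates_le hn ha)
  | succ t ih =>
    have hpair : ∀ g ∈ layerGates n ⟨t + 1, ht⟩, (brickwork hn post pre).fst g ∈ arc n a (2 * b) ↔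
        (brickwork hn post pre).snd g ∈ arc n a (2 * b) := by
      rintro ⟨_, j⟩ hg
      obtain rfl := mem_layerGates.mp hg
      exact fstSite_mem_arc_iff hn ha j
    rw [← add_assoc, pow_succ, ← div_div]
    refine BlockFamily.le_moment_append_diff _ hM hq hμ (nodup_gatesUpTo ht) hpair
      (existsUnique_mem_sites_brickwork _ ⟨a % n, Nat.mod_lt a hn₀⟩) (by positivity)
      (fun y hy => ih _ (ha.add_right 1 |>.trans ?_) fun i hi => ?_) hx
    · exact Nat.add_modEq_right
    · exact arc_diff_singleton_subset (Nat.mod_modEq a n) _ (hy i hi)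

theorem max_le_moment (hM : IsOperatorBasis M) (hq : 2 ≤ q) (hμ : ∀ g, IsTwoDesign (μ g))
    (hd : 1 ≤ d) {k : ℕ} {x : Fin n → Fin (q ^ 2)} (hx : IsSpatiallyLocal k x) :
    max (1 / ((q : ℝ) + 1) ^ k * (1 / ((q : ℝ) ^ 2 + 1) ^ (d + 1))) (1 / ((q : ℝ) + 1) ^ n) ≤
      (brickwork hn post pre).moment μ M (gatesUpTo n d le_rfl) x := by
  obtain ⟨t, rfl⟩ := Nat.exists_eq_add_of_le' hd
  obtain ⟨a, ha, hxa⟩ := hx.exists_supportedOn_arc hn t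
  have hq₀ : (0 : ℝ) ≤ q := Nat.cast_nonneg q
  refine max_le ?_ (one_div_pow_le_moment hM hq hμ _ x)
  refine le_trans ?_ (one_div_pow_le_moment_of_supportedOn_arc hM hq hμ t.lt_succ_self ha hxa)
  rw [one_div_mul_one_div]
  refine one_div_le_one_div_of_le (by positivity) ?_
  calc ((q : ℝ) ^ 2 + 1) ^ (k / 2 + 1 + t)
      = ((q : ℝ) ^ 2 + 1) ^ (k / 2) * ((q : ℝ) ^ 2 + 1) ^ (t + 1) := by ring
    _ ≤ (((q : ℝ) + 1) ^ 2) ^ (k / 2) * ((q : ℝ) ^ 2 + 1) ^ (t + 1 + 1) := by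
        gcongr
        · nlinarith
        · exact le_add_of_nonneg_left (sq_nonneg _)
        · exact Nat.le_succ _
    _ ≤ ((q : ℝ) + 1) ^ k * ((q : ℝ) ^ 2 + 1) ^ (t + 1 + 1) := by
        rw [← pow_mul]
        gcongr
        · exact le_add_of_nonneg_left hq₀
        · exact Nat.mul_div_le k 2

end Brickwork

namespace ParamGate

variable {q : ℕ} (P : ParamGate q)

theorem eval_mem_unitaryGroup (θ : ℝ) : P.eval θ ∈ unitaryGroup (Fin q × Fin q) ℂ := by
  refine mul_mem (mul_mem P.Wl.2 ?_) P.Wr.2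
  have hskew : (-(Complex.I * (θ : ℂ)) • P.A)ᴴ = -(-(Complex.I * (θ : ℂ)) • P.A) := by
    rw [conjTranspose_smul, P.isHermitian.eq]
    simp
  rw [mem_unitaryGroup_iff, star_eq_conjTranspose, ← exp_conjTranspose, hskew, exp_neg,
    mul_nonsing_inv]
  exact (isUnit_iff_isUnit_det _).mp (isUnit_exp _)

theorem continuous_eval : Continuous P.eval := by
  have hexp : Continuous (NormedSpace.exp : PairOp q → PairOp q) := by
    let _ : NormedRing (PairOp q) := Matrix.linftyOpNormedRing
    let _ : NormedAlgebra ℂ (PairOp q) := Matrix.linftyOpNormedAlgebra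
    let _ : NormedAlgebra ℚ (PairOp q) := NormedAlgebra.restrictScalars ℚ ℂ (PairOp q)
    exact NormedSpace.exp_continuous
  unfold ParamGate.eval
  fun_prop

/-- The unitary implemented by finitely many parameterized gates in a row, the gate of index `0`
acting first. -/
def evalProd {m : ℕ} (P : Fin m → ParamGate q) (θ : Fin m → ℝ) :
    unitaryGroup (Fin q × Fin q) ℂ :=
  ⟨(List.ofFn fun l => (P l).eval (θ l)).reverse.prod, list_prod_mem fun G hG => by
    obtain ⟨l, rfl⟩ := List.mem_ofFn.mp (List.mem_reverse.mp hG)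
    exact (P l).eval_mem_unitaryGroup _⟩

theorem continuous_evalProd {m : ℕ} (P : Fin m → ParamGate q) : Continuous (evalProd P) := by
  refine Continuous.subtype_mk ?_ _
  simp only [List.ofFn_eq_map, ← List.map_reverse]
  exact continuous_list_prod _ fun l _ => (P l).continuous_eval.comp (continuous_apply l)

end ParamGate

namespace BrickworkAnsatz

variable {q n d : ℕ} (𝒜 : BrickworkAnsatz q n d)

/-- The brickwork circuit obtained from the ansatz at the parameter values `θ`. -/
def blocks (hn : Even n) (θ : 𝒜.ParamIdx → ℝ) : BlockFamily q n (GateIdx n d) :=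
  brickwork hn (fun g => ParamGate.evalProd (𝒜.post g) fun l => θ (Sum.inr ⟨g, l⟩))
    fun g => ParamGate.evalProd (𝒜.pre g) fun l => θ (Sum.inl ⟨g, l⟩)

theorem layer_eq_circ (hn : Even n) (V : GateIdx n d → unitaryGroup (Fin q × Fin q) ℂ)
    (θ : 𝒜.ParamIdx → ℝ) (t : Fin d) :
    𝒜.layer V θ t = (𝒜.blocks hn θ).circ (layerGates n t) V := by
  rw [layer, BlockFamily.circ, layerGates, List.map_ofFn]
  rfl

theorem circuit_eq_circ (hn : Even n) (V : GateIdx n d → unitaryGroup (Fin q × Fin q) ℂ)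
    (θ : 𝒜.ParamIdx → ℝ) :
    𝒜.circuit V θ = (𝒜.blocks hn θ).circ (gatesUpTo n d le_rfl) V := by
  have hprefix (m : ℕ) (hm : m ≤ d) :
      (List.ofFn fun t : Fin m => 𝒜.layer V θ (t.castLE hm)).reverse.prod =
        (𝒜.blocks hn θ).circ (gatesUpTo n m hm) V := by
    induction m with
    | zero => rfl
    | succ m ih =>
      rw [List.ofFn_succ', List.concat_eq_append, List.reverse_append, List.prod_append,
        gatesUpTo, BlockFamily.circ_append, ← ih, List.reverse_singleton, List.prod_singleton,
        ← 𝒜.layer_eq_circ hn]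
      rfl
  exact hprefix d le_rfl

theorem continuous_circuit (hn : Even n) :
    Continuous fun p : (GateIdx n d → unitaryGroup (Fin q × Fin q) ℂ) × (𝒜.ParamIdx → ℝ) =>
      𝒜.circuit p.1 p.2 := by
  have hpost (g : GateIdx n d) : Continuous fun θ : 𝒜.ParamIdx → ℝ =>
      ParamGate.evalProd (𝒜.post g) fun l => θ (Sum.inr ⟨g, l⟩) :=
    (ParamGate.continuous_evalProd _).comp (by fun_prop)
  have hpre (g : GateIdx n d) : Continuous fun θ : 𝒜.ParamIdx → ℝ =>
      ParamGate.evalProd (𝒜.pre g) fun l => θ (Sum.inl ⟨g, l⟩) :=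
    (ParamGate.continuous_evalProd _).comp (by fun_prop)
  have hblock (g : GateIdx n d) :
      Continuous fun p : (GateIdx n d → unitaryGroup (Fin q × Fin q) ℂ) × (𝒜.ParamIdx → ℝ) =>
        (𝒜.blocks hn p.2).block g (p.1 g) :=
    (((hpost g).comp continuous_snd).mul ((continuous_apply g).comp continuous_fst)).mul
      ((hpre g).comp continuous_snd)
  simp only [𝒜.circuit_eq_circ hn]
  exact continuous_list_prod _ fun g _ => (continuous_onPair _ _).comp (hblock g).subtype_val

variable [NeZero q]

theorem expval_eq_heisenberg (V : GateIdx n d → unitaryGroup (Fin q × Fin q) ℂ)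
    (θ : 𝒜.ParamIdx → ℝ) (O : Op q n) : 𝒜.expval V θ O = heisenberg (𝒜.circuit V θ) O 0 0 :=
  star_zeroKet_dotProduct_mulVec _

theorem integrable_norm_sq_expval (hn : Even n)
    (ν : Measure ((GateIdx n d → unitaryGroup (Fin q × Fin q) ℂ) × (𝒜.ParamIdx → ℝ)))
    [IsFiniteMeasure ν] (O : Op q n) :
    Integrable (fun p => ‖𝒜.expval p.1 p.2 O‖ ^ 2) ν := by
  have hcont : Continuous fun U : Op q n => ‖heisenberg U O 0 0‖ ^ 2 :=
    ((continuous_heisenberg O).matrix_elem 0 0).norm.pow 2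
  obtain ⟨C, hC⟩ := isCompact_univ.exists_bound_of_continuousOn
    (hcont.comp continuous_subtype_val : Continuous fun U : unitaryGroup (Fin n → Fin q) ℂ =>
      ‖heisenberg (U : Op q n) O 0 0‖ ^ 2).continuousOn
  simp only [expval_eq_heisenberg]
  have hU (p : (GateIdx n d → unitaryGroup (Fin q × Fin q) ℂ) × (𝒜.ParamIdx → ℝ)) :
      𝒜.circuit p.1 p.2 ∈ unitaryGroup (Fin n → Fin q) ℂ := by
    rw [𝒜.circuit_eq_circ hn]
    exact BlockFamily.circ_mem_unitaryGroup _ _ _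
  exact Integrable.of_bound (hcont.comp (𝒜.continuous_circuit hn)).aestronglyMeasurable C
    (.of_forall fun p => hC ⟨_, hU p⟩ (Set.mem_univ _))

theorem le_gVal (hn : Even n) {μ : GateIdx n d → Measure (unitaryGroup (Fin q × Fin q) ℂ)}
    [∀ g, IsProbabilityMeasure (μ g)] {M : Fin (q ^ 2) → Matrix (Fin q) (Fin q) ℂ}
    {x : Fin n → Fin (q ^ 2)} {c : ℝ}
    (hc : ∀ θ, c ≤ (𝒜.blocks hn θ).moment μ M (gatesUpTo n d le_rfl) x) : c ≤ 𝒜.gVal μ M x := by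
  have huniform : IsProbabilityMeasure
      (ProbabilityTheory.cond volume (Set.Icc (0 : ℝ) (2 * Real.pi))) :=
    ProbabilityTheory.cond_isProbabilityMeasure_of_finite (by simp [Real.pi_pos])
      isCompact_Icc.measure_lt_top.ne
  unfold gVal
  set ν := Measure.pi fun _ : 𝒜.ParamIdx =>
    ProbabilityTheory.cond volume (Set.Icc (0 : ℝ) (2 * Real.pi))
  have hint := 𝒜.integrable_norm_sq_expval hn ((Measure.pi μ).prod ν) (tensorOp M x)
  have hmoment (θ : 𝒜.ParamIdx → ℝ) : ∫ V, ‖𝒜.expval V θ (tensorOp M x)‖ ^ 2 ∂(Measure.pi μ) =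
      (𝒜.blocks hn θ).moment μ M (gatesUpTo n d le_rfl) x := by
    simp only [expval_eq_heisenberg, 𝒜.circuit_eq_circ hn, BlockFamily.moment]
  rw [integral_integral_swap hint]
  calc c = ∫ _θ, c ∂ν := by rw [integral_const, probReal_univ, one_smul]
    _ ≤ _ := integral_mono (integrable_const c) hint.integral_prod_right fun θ =>
      (hc θ).trans_eq (hmoment θ).symm

end BrickworkAnsatz

theorem rpow_neg_le_one_div_pow_mul {q d k : ℕ} (hq : 2 ≤ q) (hd : 1 ≤ d) :
    (q : ℝ) ^ (-((6 : ℝ) * ((d : ℝ) + (k : ℝ)))) ≤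
      1 / ((q : ℝ) + 1) ^ k * (1 / ((q : ℝ) ^ 2 + 1) ^ (d + 1)) := by
  have hq₂ : (2 : ℝ) ≤ q := by exact_mod_cast hq
  rw [Real.rpow_neg (by positivity), one_div_mul_one_div, ← one_div,
    show (6 : ℝ) * ((d : ℝ) + (k : ℝ)) = ((6 * (d + k) : ℕ) : ℝ) by push_cast; ring,
    Real.rpow_natCast]
  refine one_div_le_one_div_of_le (by positivity) ?_
  calc ((q : ℝ) + 1) ^ k * ((q : ℝ) ^ 2 + 1) ^ (d + 1)
      ≤ ((q : ℝ) ^ 2) ^ k * ((q : ℝ) ^ 3) ^ (d + 1) := by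
        gcongr
        · nlinarith
        · nlinarith [sq_nonneg (q : ℝ)]
    _ = (q : ℝ) ^ (2 * k + 3 * (d + 1)) := by rw [← pow_mul, ← pow_mul, ← pow_add]
    _ ≤ _ := pow_le_pow_right₀ (by linarith) (by omega)

end

end VariationalCircuit

theorem corollary4 :
    ∃ C : ℝ, 0 < C ∧
      ∀ (q n d k : ℕ) [NeZero q], 2 ≤ q → Even n → 1 ≤ d →
      ∀ (𝒜 : VariationalCircuit.BrickworkAnsatz q n d)
        (μ : VariationalCircuit.GateIdx n d →
          MeasureTheory.Measure (Matrix.unitaryGroup (Fin q × Fin q) ℂ)),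
        (∀ g, VariationalCircuit.IsTwoDesign (μ g)) →
      ∀ M : Fin (q ^ 2) → Matrix (Fin q) (Fin q) ℂ, VariationalCircuit.IsOperatorBasis M →
      ∀ x : Fin n → Fin (q ^ 2), VariationalCircuit.IsSpatiallyLocal k x →
        max ((q : ℝ) ^ (-(C * ((d : ℝ) + (k : ℝ))))) (1 / ((q : ℝ) + 1) ^ n) ≤ 𝒜.gVal μ M x ∧
        max (1 / ((q : ℝ) + 1) ^ k * (1 / ((q : ℝ) ^ 2 + 1) ^ (d + 1))) (1 / ((q : ℝ) + 1) ^ n) ≤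
          𝒜.gVal μ M x := by
  refine ⟨6, by norm_num, ?_⟩
  intro q n d k _ hq hn hd 𝒜 μ hμ M hM x hx
  have := fun g => (hμ g).isProbabilityMeasure
  have h := 𝒜.le_gVal hn fun θ => VariationalCircuit.max_le_moment hM hq hμ hd hx
  exact ⟨(max_le_max_right _ (VariationalCircuit.rpow_neg_le_one_div_pow_mul hq hd)).trans h, h⟩
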